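/- Let $\mathcal K$ be a compact Polish space, $r\ge 1$ an integer, $\mathcal C=C(\mathcal K,\mathbb R)$, and let $\mathcal F\subset\mathcal C$ be a countable set with $\|f\|_\infty\le 1$ for all $f\in\mathcal F$ whose linear span is dense in $\mathcal C$ in the supremum norm. **Definitions.** For a set $S$, an $S$-decorated directed $r$-uniform hypergraph $G$ on a vertex set $V(G)$ is an $r$-array $(G_{i_1,\dots,i_r})$, $i_1,\dots,i_r\in V(G)$, whose off-diagonal entries (those with pairwise distinct $i_1,\dots,i_r$) lie in $S$ and whose other entries all equal a special symbol $\iota$. $\Pi(S)$ denotes the set of isomorphism classes of such hypergraphs with $1\le |V(G)|<\infty$, and $\mathcal L_\infty$ the set of all $\mathcal K$-decorated directed $r$-uniform hypergraphs with vertex set $\mathbb N$, with the product topology and its Borel $\sigma$-algebra. For every $f\in\mathcal C$ fix an arbitrary real value $f(\iota)$ (the value of $f$ at $\iota$ when $\iota\in\mathcal K$, a convention otherwise); the diagonal entries of a hypergraph $F\in\Pi(\mathcal C)$ are read as the constant function $1$. For $F\in\Pi(\mathcal C)$ with $V(F)=[k]$ and $G\in\Pi(\mathcal K)$ put $$t(F,G)=\frac1{|V(G)|^k}\sum_{\phi:[k]\to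 V(G)}\ \prod_{i_1,\dots,i_r=1}^k F_{i_1,\dots,i_r}\bigl(G_{\phi(i_1),\dots,\phi(i_r)}\bigr),$$ and let $t_{\mathrm{inj}}(F,G)$ be the average of the same products over all injective $\phi$ (for $k\le|V(G)|$). Let $\tau^+(G)=\bigl((t(F,G))_{F\in\Pi(\mathcal F)},\,1/|V(G)|\bigr)\in\mathbb R^{\Pi(\mathcal F)}\times\mathbb R$, let $\Pi(\mathcal K)^+=\tau^+(\Pi(\mathcal K))$, and let $X=\overline{\Pi(\mathcal K)^+}\setminus\Pi(\mathcal K)^+$, the closure being taken in the product topology. For $\Gamma\in X$ and $F\in\Pi(\mathcal C)$ let $t(F,\Gamma)$ be the limit of $t(F,G)$ as $G\in\Pi(\mathcal K)$, $\tau^+(G)\to\Gamma$. For $H\in\mathcal L_\infty$ let $H|_{[k]}$ be its restriction to the first $k$ vertices. A random element of $\mathcal L_\infty$ is exchangeable if its law is invariant under all permutations of $\mathbb N$ moving only finitely many points. Random elements are identified when they have the same law. **Theorem.** For every $F\in\Pi(\mathcal C)$ the limit defining $t(F,\Gamma)$ exists for every $\Gamma\in X$ and is a continuous function of $\Gamma\in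 X$, integrable with respect to every probability measure on $X$; for $F\in\Pi(\mathcal F)$ it is the coordinate of $\Gamma$ with index $F$. Moreover: 1. There is a bijection between the laws of random elements $\Gamma$ of $X$ and the laws of random exchangeable elements $H$ of $\mathcal L_\infty$, in which $\Gamma$ and $H$ correspond to each other if and only if $$\mathbb E\,t(F,\Gamma)=\mathbb E\,t_{\mathrm{inj}}(F,H|_{[k]})\qquad\text{for all }k\ge1\text{ and all }F\in\Pi(\mathcal C)\text{ with }V(F)=[k].$$ 2. There is a bijection between the elements $\Gamma$ of $X$ and the extreme points of the convex set of laws of random exchangeable elements $H$ of $\mathcal L_\infty$, in which $\Gamma$ and the law of $H$ correspond to each other if and only if $t(F,\Gamma)=\mathbb E\,t_{\mathrm{inj}}(F,H|_{[k]})$ for all such $k$ and $F$. It is the restriction of the bijection in 1 to non-random $\Gamma$. -/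

import Mathlib

open MeasureTheory Filter Topology
open scoped NNReal

noncomputable section

namespace DecoratedHypergraph

/-- A finite `S`-decorated directed `r`-uniform hypergraph with vertex set `[n] = Fin n`, `n ≥ 1`:
every `r`-tuple of pairwise distinct vertices carries an element of `S`. -/
structure Labeled (r : ℕ) (S : Type*) where
  n : ℕ
  pos : 0 < n
  arr : (Fin r ↪ Fin n) → S

namespace Labeled

variable {r : ℕ} {S T : Type*}

/-- The full `r`-array of a hypergraph. The off-diagonal entries (all coordinates distinct) are the
decorations, all other entries are the special element `ι`, represented by `none`. -/
def entry (G : Labeled r S) (i : Fin r → Fin G.n) : Option S :=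
  open Classical in if h : Function.Injective i then some (G.arr ⟨i, h⟩) else none

/-- Isomorphism: a bijection of the vertex sets that preserves all decorations. -/
def Iso (G G' : Labeled r S) : Prop :=
  ∃ σ : Fin G.n ≃ Fin G'.n, ∀ e, G'.arr (e.trans σ.toEmbedding) = G.arr e

theorem Iso.symm {G G' : Labeled r S} (h : Iso G G') : Iso G' G := by
  obtain ⟨σ, h⟩ := h
  refine ⟨σ.symm, fun e => ?_⟩
  rw [← h]
  congr 1
  ext x
  simp

theorem Iso.trans {G G' G'' : Labeled r S} (h : Iso G G') (h' : Iso G' G'') : Iso G G'' := by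
  obtain ⟨σ, h⟩ := h
  obtain ⟨σ', h'⟩ := h'
  refine ⟨σ.trans σ', fun e => ?_⟩
  rw [← h, ← h']
  rfl

instance setoid (r : ℕ) (S : Type*) : Setoid (Labeled r S) where
  r := Iso
  iseqv := ⟨fun _ => ⟨Equiv.refl _, fun _ => rfl⟩, Iso.symm, Iso.trans⟩

/-- Change of decorations. -/
def map (g : S → T) (G : Labeled r S) : Labeled r T := ⟨G.n, G.pos, fun e => g (G.arr e)⟩

theorem Iso.map (g : S → T) {G G' : Labeled r S} (h : Iso G G') : Iso (G.map g) (G'.map g) := by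
  obtain ⟨σ, h⟩ := h
  exact ⟨σ, fun e => congrArg g (h e)⟩

theorem Iso.n_eq {G G' : Labeled r S} (h : Iso G G') : G.n = G'.n := by
  obtain ⟨σ, _⟩ := h
  simpa using Fintype.card_congr σ

theorem entry_equiv {G G' : Labeled r S} (σ : Fin G.n ≃ Fin G'.n)
    (h : ∀ e, G'.arr (e.trans σ.toEmbedding) = G.arr e) (i : Fin r → Fin G.n) :
    G'.entry (σ ∘ i) = G.entry i := by
  unfold entry
  by_cases hi : Function.Injective i
  · rw [dif_pos hi, dif_pos (σ.injective.comp hi), ← h]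
    rfl
  · rw [dif_neg hi, dif_neg]
    exact fun hc => hi hc.of_comp

end Labeled

/-- `Unlabeled r S` is the set `Π(S) = Π_r(S)` of isomorphism classes of finite `S`-decorated
directed `r`-uniform hypergraphs. -/
def Unlabeled (r : ℕ) (S : Type*) : Type _ := Quotient (Labeled.setoid r S)

namespace Unlabeled

variable {r : ℕ} {S T : Type*}

/-- The number of vertices. -/
def size : Unlabeled r S → ℕ := Quotient.lift Labeled.n fun _ _ h => Labeled.Iso.n_eq h

theorem size_pos (G : Unlabeled r S) : 0 < G.size := Quotient.inductionOn G Labeled.pos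

/-- Change of decorations. -/
def map (g : S → T) : Unlabeled r S → Unlabeled r T :=
  Quotient.map (Labeled.map g) fun _ _ h => Labeled.Iso.map g h

end Unlabeled

section Densities

variable {K : Type*} [TopologicalSpace K] {r : ℕ}

/-- The factor `F_i (G_j)` of a homomorphism density. The number `c f` is the value `f(ι)` of the
functional `f` at the special element `ι` that occupies the diagonal of `G`; the diagonal entries
of `F` contribute the factor `1`. -/
def factor (c : C(K, ℝ) → ℝ) : Option C(K, ℝ) → Option K → ℝ
  | none, _ => 1
  | some f, some x => f x
  | some f, none => c f

namespace Labeled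

/-- The product `∏_{i_1, …, i_r = 1}^k F_{i_1 … i_r} (G_{φ(i_1) … φ(i_r)})` for a map `φ`. -/
def homProd (c : C(K, ℝ) → ℝ) (F : Labeled r C(K, ℝ)) (G : Labeled r K)
    (φ : Fin F.n → Fin G.n) : ℝ :=
  ∏ i : Fin r → Fin F.n, factor c (F.entry i) (G.entry (φ ∘ i))

/-- Homomorphism density: the average of the products over all maps `φ`. -/
def t (c : C(K, ℝ) → ℝ) (F : Labeled r C(K, ℝ)) (G : Labeled r K) : ℝ :=
  (∑ φ : Fin F.n → Fin G.n, homProd c F G φ) / (G.n : ℝ) ^ F.n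

/-- Injective homomorphism density: the average of the products over all injective maps `φ`. -/
def tInj (c : C(K, ℝ) → ℝ) (F : Labeled r C(K, ℝ)) (G : Labeled r K) : ℝ :=
  (∑ φ : Fin F.n ↪ Fin G.n, homProd c F G φ) / (Fintype.card (Fin F.n ↪ Fin G.n) : ℝ)

theorem homProd_iso (c : C(K, ℝ) → ℝ) {F F' : Labeled r C(K, ℝ)} {G G' : Labeled r K}
    (σ : Fin F.n ≃ Fin F'.n) (hσ : ∀ e, F'.arr (e.trans σ.toEmbedding) = F.arr e)
    (ρ : Fin G.n ≃ Fin G'.n) (hρ : ∀ e, G'.arr (e.trans ρ.toEmbedding) = G.arr e)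
    (φ : Fin F.n → Fin G.n) :
    homProd c F G φ = homProd c F' G' (ρ ∘ φ ∘ σ.symm) := by
  unfold homProd
  refine Fintype.prod_equiv (Equiv.arrowCongr (Equiv.refl _) σ) _ _ fun i => ?_
  have h1 : (Equiv.arrowCongr (Equiv.refl (Fin r)) σ) i = σ ∘ i := rfl
  have h2 : (ρ ∘ φ ∘ σ.symm) ∘ (σ ∘ i) = ρ ∘ (φ ∘ i) := by
    ext x
    simp
  rw [h1, h2, entry_equiv σ hσ, entry_equiv ρ hρ]

theorem t_iso (c : C(K, ℝ) → ℝ) {F F' : Labeled r C(K, ℝ)} {G G' : Labeled r K}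
    (hF : Iso F F') (hG : Iso G G') : t c F G = t c F' G' := by
  have hn : (F'.n, G'.n) = (F.n, G.n) := by rw [hF.n_eq, hG.n_eq]
  obtain ⟨h1, h2⟩ := Prod.mk.inj hn
  obtain ⟨σ, hσ⟩ := hF
  obtain ⟨ρ, hρ⟩ := hG
  have hs : ∑ φ : Fin F.n → Fin G.n, homProd c F G φ =
      ∑ φ : Fin F'.n → Fin G'.n, homProd c F' G' φ :=
    Fintype.sum_equiv (Equiv.arrowCongr σ ρ) _ _ fun φ => homProd_iso c σ hσ ρ hρ φ
  have hd : (G.n : ℝ) ^ F.n = (G'.n : ℝ) ^ F'.n := by rw [h1, h2]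
  unfold t
  rw [hs, hd]

theorem tInj_iso (c : C(K, ℝ) → ℝ) {F F' : Labeled r C(K, ℝ)} {G G' : Labeled r K}
    (hF : Iso F F') (hG : Iso G G') : tInj c F G = tInj c F' G' := by
  obtain ⟨σ, hσ⟩ := hF
  obtain ⟨ρ, hρ⟩ := hG
  unfold tInj
  congr 1
  · exact Fintype.sum_equiv (Equiv.embeddingCongr σ ρ) _ _ fun φ => homProd_iso c σ hσ ρ hρ φ
  · rw [Fintype.card_congr (Equiv.embeddingCongr σ ρ)]

end Labeled

/-- The homomorphism density `t(F, G)` for `F ∈ Π(C(K))` and `G ∈ Π(K)`. -/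
def t (c : C(K, ℝ) → ℝ) : Unlabeled r C(K, ℝ) → Unlabeled r K → ℝ :=
  Quotient.lift₂ (Labeled.t c) fun _ _ _ _ hF hG => Labeled.t_iso c hF hG

/-- The injective homomorphism density `t_inj(F, G)` for `F ∈ Π(C(K))` and `G ∈ Π(K)`. -/
def tInj (c : C(K, ℝ) → ℝ) : Unlabeled r C(K, ℝ) → Unlabeled r K → ℝ :=
  Quotient.lift₂ (Labeled.tInj c) fun _ _ _ _ hF hG => Labeled.tInj_iso c hF hG

variable (r) in
/-- `τ⁺(G) = ((t(F, G))_{F ∈ Π(𝓕)}, 1 / |V(G)|)`. -/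
def tauPlus (c : C(K, ℝ) → ℝ) (𝓕 : Set C(K, ℝ)) (G : Unlabeled r K) :
    (Unlabeled r 𝓕 → ℝ) × ℝ :=
  (fun F => t c (F.map Subtype.val) G, 1 / (G.size : ℝ))

variable (r) in
/-- `Π(K)⁺`, the range of `τ⁺`. -/
def PiPlus (c : C(K, ℝ) → ℝ) (𝓕 : Set C(K, ℝ)) : Set ((Unlabeled r 𝓕 → ℝ) × ℝ) :=
  Set.range (tauPlus r c 𝓕)

variable (r) in
/-- The space of limit points: the closure of `Π(K)⁺` without `Π(K)⁺`. -/
def LimitSpace (c : C(K, ℝ) → ℝ) (𝓕 : Set C(K, ℝ)) : Set ((Unlabeled r 𝓕 → ℝ) × ℝ) :=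
  closure (PiPlus r c 𝓕) \ PiPlus r c 𝓕

/-- The trace on `Π(K)` of the neighbourhoods of the limit point `Γ`. -/
def nhdsTrace {c : C(K, ℝ) → ℝ} {𝓕 : Set C(K, ℝ)} (Γ : LimitSpace r c 𝓕) :
    Filter (Unlabeled r K) :=
  comap (tauPlus r c 𝓕) (𝓝 (Γ : (Unlabeled r 𝓕 → ℝ) × ℝ))

/-- The density `t(F, Γ)` for `F ∈ Π(C(K))` and a limit point `Γ`: the continuous extension of
`t(F, ·)`, that is, the limit of `t(F, G)` as `τ⁺(G)` tends to `Γ`. -/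
def tLim {c : C(K, ℝ) → ℝ} {𝓕 : Set C(K, ℝ)} (F : Unlabeled r C(K, ℝ))
    (Γ : LimitSpace r c 𝓕) : ℝ :=
  limUnder (nhdsTrace Γ) (t c F)

end Densities

/-- `𝓛_∞`: the `S`-decorated directed `r`-uniform hypergraphs with vertex set `ℕ`. -/
abbrev LInfty (r : ℕ) (S : Type*) : Type _ := (Fin r ↪ ℕ) → S

namespace LInfty

variable {r : ℕ} {S : Type*}

/-- The restriction `H|_[k]` to the first `k ≥ 1` vertices, as an element of `Π(S)`. -/
def restrict (k : ℕ) (hk : 0 < k) (H : LInfty r S) : Unlabeled r S :=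
  Quotient.mk (Labeled.setoid r S) ⟨k, hk, fun e => H (e.trans Fin.valEmbedding)⟩

/-- Relabeling of the vertices: `(H_{i_1 … i_r}) ↦ (H_{ρ(i_1) … ρ(i_r)})`. -/
def permute (ρ : Equiv.Perm ℕ) (H : LInfty r S) : LInfty r S :=
  fun e => H (e.trans ρ.toEmbedding)

end LInfty

/-- The laws of random exchangeable elements of `𝓛_∞`: the probability measures that are invariant
under all permutations of the vertex set that move only finitely many vertices. -/
def exchangeableLaws (r : ℕ) (S : Type*) [MeasurableSpace S] : Set (Measure (LInfty r S)) :=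
  {ν | IsProbabilityMeasure ν ∧
    ∀ ρ : Equiv.Perm ℕ, {i | ρ i ≠ i}.Finite → ν.map (LInfty.permute ρ) = ν}

end DecoratedHypergraph

end

open DecoratedHypergraph

noncomputable section

/-! A finite hypergraph G, with a fixed point x₀ of K written on its diagonal, yields an
exchangeable hypergraph on ℕ by sampling independent uniform vertices. The integral of a monomial ∏
a_e(H_e) under this law is an average over all maps [k] → V(G); it differs from t(F, G) only through
the non-injective maps, hence by a quantity that vanishes as |V(G)| → ∞. When τ⁺(G) tends to Γ ∈ X
the size does tend to infinity, so the monomial integrals with entries in 𝓕 converge. Since 𝓛_∞ is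
compact and these integrals determine a law, the sampling laws converge weakly to an exchangeable
law `limitLaw`, whose monomial integrals are the t(F, Γ).

Averaging over a random Γ gives the affine map `mixture`. It is injective because the product of two
densities is the density of a disjoint union: the densities span an algebra of continuous functions
that separates the points of the compact space X, so their integrals determine the law of Γ
(`ext_of_integral_tLim`). It is surjective because, for exchangeable H, the laws of τ⁺(H|_[n]) have
a weak cluster point, which lives on X and has the right expected densities
(`exists_measure_integral_coordinate`). An affine bijection preserves extreme points, and those of
the probability measures on X are the Dirac masses (`mem_extremePoints_iff_of_bind`). -/

namespace DecoratedHypergraph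

/-! ### Averages over all maps against averages over injective maps -/

section Averages

/-- The proportion of non-injective maps among all maps `Fin k → Fin n`. -/
def collision (k n : ℕ) : ℝ := 1 - (n.descFactorial k : ℝ) / (n : ℝ) ^ k

theorem tendsto_collision (k : ℕ) : Tendsto (collision k) atTop (𝓝 0) := by
  have h := isEquivalent_descFactorial k
  have hz : ∀ᶠ x : ℕ in atTop, ((x : ℝ) ^ k) ≠ 0 :=
    eventually_atTop.mpr ⟨1, fun n hn => pow_ne_zero _ (by positivity)⟩
  rw [Asymptotics.isEquivalent_iff_tendsto_one hz] at h
  have h' := h.const_sub 1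
  rw [sub_self] at h'
  exact h'

theorem card_filter_not_injective (k n : ℕ) :
    ((Finset.univ.filter fun φ : Fin k → Fin n => ¬ Function.Injective φ).card : ℝ) =
      (n : ℝ) ^ k - n.descFactorial k := by
  classical
  have h1 := Finset.card_filter_add_card_filter_not (s := (Finset.univ : Finset (Fin k → Fin n)))
    (p := fun φ => Function.Injective φ)
  have h2 : (Finset.univ.filter fun φ : Fin k → Fin n => Function.Injective φ).card =
      n.descFactorial k := by
    rw [← Fintype.card_subtype, Fintype.card_congr (Equiv.subtypeInjectiveEquivEmbedding _ _),
      Fintype.card_embedding_eq, Fintype.card_fin, Fintype.card_fin]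
  rw [h2] at h1
  simp only [Finset.card_univ, Fintype.card_fun, Fintype.card_fin] at h1
  rw [eq_sub_iff_add_eq']
  exact_mod_cast h1

/-- Averages of two functions of `φ : Fin k → Fin n` that agree at injective `φ`. -/
theorem abs_average_sub_average_le {k n : ℕ} (hn : 0 < n) {u v : (Fin k → Fin n) → ℝ} {D : ℝ}
    (hD : ∀ φ, |u φ - v φ| ≤ D) (h : ∀ φ, Function.Injective φ → u φ = v φ) :
    |(∑ φ, u φ) / (n : ℝ) ^ k - (∑ φ, v φ) / (n : ℝ) ^ k| ≤ D * collision k n := by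
  classical
  have hpos : (0 : ℝ) < (n : ℝ) ^ k := by positivity
  have h1 : |∑ φ, u φ - ∑ φ, v φ| ≤ D * ((n : ℝ) ^ k - n.descFactorial k) := by
    rw [← Finset.sum_sub_distrib, ← card_filter_not_injective]
    calc |∑ φ, (u φ - v φ)| ≤ ∑ φ, |u φ - v φ| := Finset.abs_sum_le_sum_abs _ _
      _ ≤ ∑ φ, if Function.Injective φ then 0 else D := by
          refine Finset.sum_le_sum fun φ _ => ?_
          split_ifs with hφ
          · rw [h φ hφ]; simp
          · exact hD φ
      _ = _ := by
          rw [Finset.sum_ite, Finset.sum_const_zero, zero_add, Finset.sum_const, nsmul_eq_mul,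
            mul_comm]
  rw [← sub_div, abs_div, abs_of_pos hpos, div_le_iff₀ hpos, collision]
  calc _ ≤ _ := h1
    _ = _ := by field_simp

end Averages

/-! ### Monomials and densities with a filled diagonal -/

variable {K : Type*} [TopologicalSpace K] {r : ℕ}

theorem abs_prod_apply_le [CompactSpace K] {ι : Type*} [Fintype ι] (a : ι → C(K, ℝ))
    (x : ι → K) : |∏ e, a e (x e)| ≤ ∏ e, ‖a e‖ := by
  rw [Finset.abs_prod]
  exact Finset.prod_le_prod (fun _ _ => abs_nonneg _) fun e _ => (a e).norm_coe_le_norm (x e)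

/-- The function `H ↦ ∏ a_e (H_e)` of an infinite hypergraph `H`, the product being over the
`r`-tuples `e` of distinct vertices in `[k]`. -/
def monomial {k : ℕ} (a : (Fin r ↪ Fin k) → C(K, ℝ)) : C(LInfty r K, ℝ) :=
  ∏ e, (a e).comp ⟨fun H => H (e.trans Fin.valEmbedding), continuous_apply _⟩

@[simp]
theorem monomial_apply {k : ℕ} (a : (Fin r ↪ Fin k) → C(K, ℝ)) (H : LInfty r K) :
    monomial a H = ∏ e, a e (H (e.trans Fin.valEmbedding)) := by
  simp [monomial]

namespace Labeled

/-- The `r`-array of `G` with `x₀` on the diagonal. -/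
def fill (x₀ : K) (G : Labeled r K) (i : Fin r → Fin G.n) : K := (G.entry i).getD x₀

/-- The average over all `φ : [k] → V(G)` of `∏ a_e (G_{φ ∘ e})`, where `G` has `x₀` on its
diagonal. -/
def density (x₀ : K) {k : ℕ} (a : (Fin r ↪ Fin k) → C(K, ℝ)) (G : Labeled r K) : ℝ :=
  (∑ φ : Fin k → Fin G.n, ∏ e : Fin r ↪ Fin k, a e (G.fill x₀ (φ ∘ e))) / (G.n : ℝ) ^ k

theorem entry_of_injective {S : Type*} (G : Labeled r S) {i : Fin r → Fin G.n}
    (h : Function.Injective i) : G.entry i = some (G.arr ⟨i, h⟩) := dif_pos h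

omit [TopologicalSpace K] in
theorem fill_of_injective (x₀ : K) (G : Labeled r K) {i : Fin r → Fin G.n}
    (h : Function.Injective i) : G.fill x₀ i = G.arr ⟨i, h⟩ := by
  simp [fill, entry_of_injective G h]

/-- Diagonal entries of `F` contribute 1. The entries of `G` that remain may still be diagonal,
since `φ` need not be injective. -/
theorem homProd_eq_prod_embedding (c : C(K, ℝ) → ℝ) (F : Labeled r C(K, ℝ)) (G : Labeled r K)
    (φ : Fin F.n → Fin G.n) :
    homProd c F G φ =
      ∏ e : Fin r ↪ Fin F.n, factor c (some (F.arr e)) (G.entry (φ ∘ e)) := by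
  symm
  refine Fintype.prod_of_injective (fun e : Fin r ↪ Fin F.n => (e : Fin r → Fin F.n))
    DFunLike.coe_injective _ _ (fun i hi => ?_) fun e => ?_
  · have : F.entry i = none := dif_neg fun h => hi ⟨⟨i, h⟩, rfl⟩
    rw [this]; rfl
  · rw [entry_of_injective F e.injective]; rfl

theorem homProd_of_injective (c : C(K, ℝ) → ℝ) (F : Labeled r C(K, ℝ)) (G : Labeled r K)
    {φ : Fin F.n → Fin G.n} (hφ : Function.Injective φ) :
    homProd c F G φ = ∏ e : Fin r ↪ Fin F.n, F.arr e (G.arr (e.trans ⟨φ, hφ⟩)) := by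
  rw [homProd_eq_prod_embedding]
  refine Finset.prod_congr rfl fun e _ => ?_
  rw [entry_of_injective G (hφ.comp e.injective)]; rfl

/-- A bound for all factors of a homomorphism density. -/
def bound (c : C(K, ℝ) → ℝ) [CompactSpace K] (F : Labeled r C(K, ℝ)) : ℝ :=
  ∏ e, max ‖F.arr e‖ |c (F.arr e)|

theorem prod_norm_le_bound [CompactSpace K] (c : C(K, ℝ) → ℝ) (F : Labeled r C(K, ℝ)) :
    ∏ e, ‖F.arr e‖ ≤ bound c F :=
  Finset.prod_le_prod (fun _ _ => norm_nonneg _) fun _ _ => le_max_left _ _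

theorem abs_homProd_le [CompactSpace K] (c : C(K, ℝ) → ℝ) (F : Labeled r C(K, ℝ))
    (G : Labeled r K) (φ : Fin F.n → Fin G.n) : |homProd c F G φ| ≤ bound c F := by
  rw [homProd_eq_prod_embedding, Finset.abs_prod]
  refine Finset.prod_le_prod (fun _ _ => abs_nonneg _) fun e _ => ?_
  rcases G.entry (φ ∘ e) with _ | x
  · exact le_max_right _ _
  · exact ((F.arr e).norm_coe_le_norm x).trans (le_max_left _ _)

theorem abs_t_le [CompactSpace K] (c : C(K, ℝ) → ℝ) (F : Labeled r C(K, ℝ)) (G : Labeled r K) :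
    |t c F G| ≤ bound c F := by
  have hpos : (0 : ℝ) < (G.n : ℝ) ^ F.n := pow_pos (by exact_mod_cast G.pos) _
  rw [t, abs_div, abs_of_pos hpos, div_le_iff₀ hpos]
  refine (Finset.abs_sum_le_sum_abs _ _).trans
    ((Finset.sum_le_sum fun φ _ => abs_homProd_le c F G φ).trans ?_)
  simp [mul_comm]

/-- The conventions `c` and `x₀` for the diagonal of `G` matter only for non-injective `φ`. There
each of the two products is at most `bound c F` in absolute value, whence the factor 2. -/
theorem abs_t_sub_density_le [CompactSpace K] (c : C(K, ℝ) → ℝ) (x₀ : K)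
    (F : Labeled r C(K, ℝ)) (G : Labeled r K) :
    |t c F G - density x₀ F.arr G| ≤ 2 * bound c F * collision F.n G.n := by
  refine abs_average_sub_average_le G.pos (fun φ => ?_) fun φ hφ => ?_
  · have h1 := abs_homProd_le c F G φ
    have h2 := (abs_prod_apply_le F.arr fun e => G.fill x₀ (φ ∘ e)).trans (prod_norm_le_bound c F)
    exact (abs_sub _ _).trans (by linarith)
  · rw [homProd_of_injective c F G hφ]
    refine Finset.prod_congr rfl fun e _ => ?_
    rw [fill_of_injective x₀ G (hφ.comp e.injective)]; rfl

end Labeled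

/-! ### Multiplicativity of densities -/

section DisjointUnion

/-- The decorations of the disjoint union: the tuples that meet both parts get the function `1`. -/
def disjointUnion {k l : ℕ} (a : (Fin r ↪ Fin k) → C(K, ℝ)) (b : (Fin r ↪ Fin l) → C(K, ℝ)) :
    (Fin r ↪ Fin (k + l)) → C(K, ℝ) :=
  Function.extend (fun e => e.trans (Fin.castAddEmb l)) a (fun _ => 1) *
    Function.extend (fun e => e.trans (Fin.natAddEmb k)) b (fun _ => 1)

theorem prod_extend_one {ι κ : Type*} [Fintype ι] [Fintype κ] {f : ι → κ}
    (hf : Function.Injective f) (a : ι → C(K, ℝ)) (x : κ → K) :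
    ∏ j, Function.extend f a (fun _ => 1) j (x j) = ∏ i, a i (x (f i)) := by
  symm
  refine Fintype.prod_of_injective f hf _ _ (fun j hj => ?_) fun i => ?_
  · rw [Function.extend_apply' _ _ _ hj]; rfl
  · rw [hf.extend_apply]

theorem prod_disjointUnion {k l : ℕ} (a : (Fin r ↪ Fin k) → C(K, ℝ))
    (b : (Fin r ↪ Fin l) → C(K, ℝ)) (x : (Fin r ↪ Fin (k + l)) → K) :
    ∏ e, disjointUnion a b e (x e) =
      (∏ e, a e (x (e.trans (Fin.castAddEmb l)))) *
        ∏ e, b e (x (e.trans (Fin.natAddEmb k))) := by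
  have h1 : Function.Injective fun e : Fin r ↪ Fin k => e.trans (Fin.castAddEmb l) :=
    fun e e' h => by
      ext i
      simpa using congrArg (fun g : Fin r ↪ Fin (k + l) => (g i : ℕ)) h
  have h2 : Function.Injective fun e : Fin r ↪ Fin l => e.trans (Fin.natAddEmb k) :=
    fun e e' h => by
      ext i
      simpa using congrArg (fun g : Fin r ↪ Fin (k + l) => (g i : ℕ)) h
  rw [← prod_extend_one h1, ← prod_extend_one h2, ← Finset.prod_mul_distrib]
  rfl

/-- A map from [k + l] is a pair of maps from [k] and [l], so the average factors exactly. This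
would fail for averages over injective maps. -/
theorem Labeled.density_disjointUnion (x₀ : K) {k l : ℕ} (a : (Fin r ↪ Fin k) → C(K, ℝ))
    (b : (Fin r ↪ Fin l) → C(K, ℝ)) (G : Labeled r K) :
    G.density x₀ (disjointUnion a b) = G.density x₀ a * G.density x₀ b := by
  unfold density
  rw [div_mul_div_comm, ← pow_add, Finset.sum_mul_sum, ← Finset.sum_product',
    Finset.univ_product_univ]
  congr 1
  refine (Fintype.sum_equiv (Fin.appendEquiv k l) _ _ fun p => ?_).symm
  rw [prod_disjointUnion]
  congr 1 <;> refine Finset.prod_congr rfl fun e _ => ?_ <;> congr 2 <;> ext i <;>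
    simp [Fin.appendEquiv]

end DisjointUnion

instance {r : ℕ} : Countable (Fin r ↪ ℕ) :=
  (DFunLike.coe_injective : Function.Injective fun e : Fin r ↪ ℕ => (e : Fin r → ℕ)).countable

/-! ### Sampling an infinite hypergraph from a finite one -/

section Sampling

variable {K : Type*} [TopologicalSpace K] [PolishSpace K] [CompactSpace K] [MeasurableSpace K]
  [BorelSpace K] {r : ℕ}

instance {S : Type*} (G : Labeled r S) : Nonempty (Fin G.n) := ⟨⟨0, G.pos⟩⟩

namespace Labeled

/-- The hypergraph on `ℕ` obtained from a sequence of vertices of `G`. -/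
def pullback (x₀ : K) (G : Labeled r K) (X : ℕ → Fin G.n) : LInfty r K :=
  fun e => G.fill x₀ (X ∘ e)

omit [PolishSpace K] [CompactSpace K] [TopologicalSpace K] [BorelSpace K] in
theorem measurable_pullback (x₀ : K) (G : Labeled r K) : Measurable (G.pullback x₀) := by
  refine measurable_pi_lambda _ fun e => ?_
  have h : Measurable fun X : ℕ → Fin G.n => fun i : Fin r => X (e i) :=
    measurable_pi_lambda _ fun i => measurable_pi_apply _
  exact (measurable_of_finite (G.fill x₀)).comp h

/-- The law of an infinite sequence of independent uniformly distributed vertices. -/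
def vertexLaw (G : Labeled r K) : Measure (ℕ → Fin G.n) :=
  Measure.infinitePi fun _ => (PMF.uniformOfFintype (Fin G.n)).toMeasure

instance (G : Labeled r K) : IsProbabilityMeasure (vertexLaw G) := by
  unfold vertexLaw; infer_instance

/-- The law of the random infinite hypergraph sampled from `G` with replacement. -/
def sampleLaw (x₀ : K) (G : Labeled r K) : ProbabilityMeasure (LInfty r K) :=
  ⟨(vertexLaw G).map (G.pullback x₀),
    Measure.isProbabilityMeasure_map (G.measurable_pullback x₀).aemeasurable⟩

-- The first k sampled vertices form a uniformly distributed map [k] → V(G), and the monomial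
-- depends on no others.
omit [CompactSpace K] in
theorem integral_sampleLaw_monomial (x₀ : K) (G : Labeled r K) {k : ℕ}
    (a : (Fin r ↪ Fin k) → C(K, ℝ)) :
    ∫ H, monomial a H ∂(G.sampleLaw x₀ : Measure (LInfty r K)) = G.density x₀ a := by
  have h1 : ((sampleLaw x₀ G : ProbabilityMeasure _) : Measure (LInfty r K)) =
    (vertexLaw G).map (G.pullback x₀) := rfl
  rw [h1, integral_map (G.measurable_pullback x₀).aemeasurable
    (monomial a).continuous.aestronglyMeasurable]
  set g : (Fin k → Fin G.n) → ℝ := fun φ => ∏ e, a e (G.fill x₀ (φ ∘ e))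
  have h2 : ∀ X, monomial a (G.pullback x₀ X) = g (fun i => X (Fin.valEmbedding i)) := fun X => by
    simp only [monomial_apply, pullback, g]
    rfl
  simp_rw [h2]
  have hm : Measurable fun (X : ℕ → Fin G.n) (i : Fin k) => X (Fin.valEmbedding i) :=
    measurable_pi_lambda _ fun i => measurable_pi_apply _
  rw [← integral_map (f := g) hm.aemeasurable
    (measurable_of_finite g).aestronglyMeasurable, vertexLaw,
    Measure.map_infinitePi_infinitePi_of_inj Fin.valEmbedding.injective, Measure.infinitePi_eq_pi,
    integral_fintype .of_finite, density, Finset.sum_div]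
  refine Finset.sum_congr rfl fun φ _ => ?_
  rw [measureReal_def, Measure.pi_singleton]
  simp [g, div_eq_inv_mul]

-- Relabeling the sampled hypergraph amounts to permuting an i.i.d. sequence of vertices.
omit [TopologicalSpace K] [PolishSpace K] [CompactSpace K] [BorelSpace K] in
theorem map_permute_sampleLaw (x₀ : K) (G : Labeled r K) (ρ : Equiv.Perm ℕ) :
    (G.sampleLaw x₀ : Measure (LInfty r K)).map (LInfty.permute ρ) = G.sampleLaw x₀ := by
  have h1 : ((sampleLaw x₀ G : ProbabilityMeasure _) : Measure (LInfty r K)) =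
    (vertexLaw G).map (G.pullback x₀) := rfl
  have hm : Measurable (LInfty.permute ρ : LInfty r K → LInfty r K) :=
    measurable_pi_lambda _ fun i => measurable_pi_apply _
  have hm' : Measurable fun (X : ℕ → Fin G.n) (i : ℕ) => X (ρ i) :=
    measurable_pi_lambda _ fun i => measurable_pi_apply _
  rw [h1, Measure.map_map hm (G.measurable_pullback x₀)]
  have h2 : LInfty.permute ρ ∘ G.pullback x₀ =
    G.pullback x₀ ∘ fun (X : ℕ → Fin G.n) (i : ℕ) => X (ρ i) := rfl
  rw [h2, ← Measure.map_map (G.measurable_pullback x₀) hm', vertexLaw,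
    Measure.map_infinitePi_infinitePi_of_inj ρ.injective]

end Labeled

end Sampling

/-! ### Monomial integrals determine laws and weak limits -/

section Determinacy

variable {K : Type*} [TopologicalSpace K] [PolishSpace K] [CompactSpace K] [MeasurableSpace K]
  [BorelSpace K] {r : ℕ}

theorem integrable_of_continuousMap {Y : Type*} [TopologicalSpace Y] [CompactSpace Y]
    [MeasurableSpace Y] [BorelSpace Y] (g : C(Y, ℝ)) (μ : Measure Y) [IsFiniteMeasure μ] :
    Integrable g μ :=
  (BoundedContinuousFunction.mkOfCompact g).integrable μ

-- Products of functions of single coordinates determine the finite-dimensional marginals, and these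
-- determine the law.
omit [CompactSpace K] in
theorem ext_of_integral_monomial {μ ν : Measure (LInfty r K)} [IsProbabilityMeasure μ]
    [IsProbabilityMeasure ν]
    (h : ∀ k, 0 < k → ∀ a : (Fin r ↪ Fin k) → C(K, ℝ),
      ∫ H, monomial a H ∂μ = ∫ H, monomial a H ∂ν) : μ = ν := by
  refine IsProjectiveLimit.unique (P := fun I : Finset (Fin r ↪ ℕ) => ν.map I.restrict)
    (fun I => ?_) fun I => rfl
  obtain ⟨k, hk, hI⟩ : ∃ k, 0 < k ∧ ∀ i : I, ∀ x, (i : Fin r ↪ ℕ) x < k := by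
    -- One more than the largest vertex occurring in `I`, so that every tuple in `I` lies in [k].
    refine ⟨(I.sup fun i => Finset.univ.sup i) + 1, Nat.succ_pos _, fun i x => ?_⟩
    exact Nat.lt_succ_of_le ((Finset.le_sup (f := (i : Fin r ↪ ℕ)) (Finset.mem_univ x)).trans
      (Finset.le_sup (f := fun i : Fin r ↪ ℕ => Finset.univ.sup i) i.2))
  have key : ∀ f : I → C(K, ℝ), ∫ x, ∏ i, f i (x i) ∂(μ.map I.restrict) =
      ∫ x, ∏ i, f i (x i) ∂(ν.map I.restrict) := fun f => by
    let j : I → (Fin r ↪ Fin k) := fun i =>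
      ⟨fun x => ⟨(i : Fin r ↪ ℕ) x, hI i x⟩, fun x y hxy => i.1.injective (Fin.mk.inj_iff.1 hxy)⟩
    have hj : ∀ i, (j i).trans Fin.valEmbedding = i := fun i => rfl
    have hji : Function.Injective j := fun i i' hii => Subtype.ext (by rw [← hj, ← hj, hii])
    have h0 : ∀ H : LInfty r K,
        monomial (Function.extend j f fun _ => 1) H = ∏ i, f i (I.restrict H i) := fun H => by
      rw [monomial_apply,
        prod_extend_one hji f fun e : Fin r ↪ Fin k => H (e.trans Fin.valEmbedding)]
      rfl
    have hc : Continuous fun x : I → K => ∏ i, f i (x i) := by fun_prop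
    rw [integral_map (Finset.measurable_restrict I).aemeasurable hc.aestronglyMeasurable,
      integral_map (Finset.measurable_restrict I).aemeasurable hc.aestronglyMeasurable]
    simp_rw [← h0]
    exact h k hk _
  have hp : ∀ ξ : Measure (LInfty r K), IsProbabilityMeasure ξ →
      IsProbabilityMeasure (ξ.map I.restrict) := fun ξ _ =>
    Measure.isProbabilityMeasure_map (Finset.measurable_restrict I).aemeasurable
  have := hp μ inferInstance
  have := hp ν inferInstance
  -- The uniqueness theorem applied below concerns products over two families of coordinates; the
  -- second family is taken empty, and `Prod.fst` recovers `ξ`.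
  let P : ∀ ξ : Measure (I → K), Measure ((I → K) × (Empty → K)) := fun ξ =>
    ξ.map fun x => (x, Empty.elim)
  have hm : Measurable fun x : I → K => (x, (Empty.elim : Empty → K)) := by fun_prop
  have hP : ∀ ξ : Measure (I → K), (P ξ).map Prod.fst = ξ := fun ξ => by
    rw [Measure.map_map measurable_fst hm]
    exact Measure.map_id
  change μ.map I.restrict = ν.map I.restrict
  rw [← hP (μ.map I.restrict), ← hP (ν.map I.restrict)]
  congr 1
  refine Measure.ext_of_integral_prod_mul_prod_boundedContinuousFunction fun f g => ?_
  have hc : Continuous fun p : (I → K) × (Empty → K) =>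
    (∏ i, f i (p.1 i)) * ∏ j, g j (p.2 j) := by fun_prop
  rw [integral_map hm.aemeasurable hc.aestronglyMeasurable,
    integral_map hm.aemeasurable hc.aestronglyMeasurable]
  simpa using key fun i => (f i).toContinuousMap

/-- Integration of `f (H_{e₀}) g(H)` as a functional of `f`. -/
def integralMulCLM (μ : Measure (LInfty r K)) [IsProbabilityMeasure μ] (e₀ : Fin r ↪ ℕ)
    (g : C(LInfty r K, ℝ)) : C(K, ℝ) →L[ℝ] ℝ :=
  LinearMap.mkContinuous
    { toFun := fun f => ∫ H, f (H e₀) * g H ∂μ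
      map_add' := fun f f' => by
        rw [← integral_add]
        · simp [add_mul]
        · exact integrable_of_continuousMap
            ⟨fun H : LInfty r K => f (H e₀) * g H, by fun_prop⟩ μ
        · exact integrable_of_continuousMap
            ⟨fun H : LInfty r K => f' (H e₀) * g H, by fun_prop⟩ μ
      map_smul' := fun s f => by
        simp [mul_assoc, integral_const_mul] }
    ‖g‖ fun f => by
      refine (norm_integral_le_of_norm_le_const (C := ‖g‖ * ‖f‖) (.of_forall fun H => ?_)).trans
        (by simp)
      rw [norm_mul, mul_comm]
      exact mul_le_mul (g.norm_coe_le_norm H) (f.norm_coe_le_norm _) (norm_nonneg _) (norm_nonneg _)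

/-- The integral is linear and continuous in each factor separately. Hence the factors can be
released from 𝓕 one at a time, two continuous functionals that agree on 𝓕 being equal. -/
theorem integral_monomial_eq_of_dense {μ ν : Measure (LInfty r K)} [IsProbabilityMeasure μ]
    [IsProbabilityMeasure ν] {𝓕 : Set C(K, ℝ)}
    (h_gen : Dense (Submodule.span ℝ 𝓕 : Set C(K, ℝ))) {k : ℕ}
    (h : ∀ a : (Fin r ↪ Fin k) → C(K, ℝ), (∀ e, a e ∈ 𝓕) →
      ∫ H, monomial a H ∂μ = ∫ H, monomial a H ∂ν) (a : (Fin r ↪ Fin k) → C(K, ℝ)) :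
    ∫ H, monomial a H ∂μ = ∫ H, monomial a H ∂ν := by
  classical
  -- `s` is the set of positions already released from 𝓕.
  suffices H : ∀ (s : Finset (Fin r ↪ Fin k)) (a : (Fin r ↪ Fin k) → C(K, ℝ)),
      (∀ e, e ∉ s → a e ∈ 𝓕) → ∫ H, monomial a H ∂μ = ∫ H, monomial a H ∂ν from
    H Finset.univ a (by simp)
  intro s
  induction s using Finset.induction_on with
  | empty => exact fun a ha => h a fun e => ha e (by simp)
  | insert e₀ s _ ih =>
    intro a ha
    let g : C(LInfty r K, ℝ) := ∏ e ∈ Finset.univ.erase e₀,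
      (a e).comp ⟨fun H => H (e.trans Fin.valEmbedding), continuous_apply _⟩
    have hg : ∀ (f : C(K, ℝ)) (H : LInfty r K),
        monomial (Function.update a e₀ f) H = f (H (e₀.trans Fin.valEmbedding)) * g H := by
      intro f H
      rw [monomial_apply, ← Finset.mul_prod_erase _ _ (Finset.mem_univ e₀), Function.update_self,
        ContinuousMap.coe_prod, Finset.prod_apply]
      congr 1
      refine Finset.prod_congr rfl fun e he => ?_
      rw [Function.update_of_ne (Finset.ne_of_mem_erase he)]
      rfl
    have hL : integralMulCLM μ (e₀.trans Fin.valEmbedding) g =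
        integralMulCLM ν (e₀.trans Fin.valEmbedding) g := by
      refine ContinuousLinearMap.ext_on h_gen fun f hf => ?_
      change ∫ H, f (H (e₀.trans Fin.valEmbedding)) * g H ∂μ =
        ∫ H, f (H (e₀.trans Fin.valEmbedding)) * g H ∂ν
      simp_rw [← hg]
      refine ih _ fun e he => ?_
      by_cases hee : e = e₀
      · subst hee; rwa [Function.update_self]
      · rw [Function.update_of_ne hee]
        exact ha e (by simp [hee, he])
    have := congrArg (fun L => L (a e₀)) hL
    change ∫ H, a e₀ (H (e₀.trans Fin.valEmbedding)) * g H ∂μ =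
        ∫ H, a e₀ (H (e₀.trans Fin.valEmbedding)) * g H ∂ν at this
    simp_rw [← hg, Function.update_eq_self] at this
    exact this

theorem ext_of_integral_monomial_of_dense {μ ν : Measure (LInfty r K)} [IsProbabilityMeasure μ]
    [IsProbabilityMeasure ν] {𝓕 : Set C(K, ℝ)}
    (h_gen : Dense (Submodule.span ℝ 𝓕 : Set C(K, ℝ)))
    (h : ∀ k, 0 < k → ∀ a : (Fin r ↪ Fin k) → C(K, ℝ), (∀ e, a e ∈ 𝓕) →
      ∫ H, monomial a H ∂μ = ∫ H, monomial a H ∂ν) : μ = ν :=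
  ext_of_integral_monomial fun k hk => integral_monomial_eq_of_dense h_gen (h k hk)

theorem continuous_integral_law {Y : Type*} [TopologicalSpace Y] [CompactSpace Y]
    [MeasurableSpace Y] [BorelSpace Y] (g : C(Y, ℝ)) :
    Continuous fun μ : ProbabilityMeasure Y => ∫ y, g y ∂(μ : Measure Y) :=
  ProbabilityMeasure.continuous_integral_continuousMap g

/-- The probability measures on the compact space 𝓛_∞ form a compact space, so it suffices that `ν`
is the only possible cluster point. -/
theorem tendsto_of_tendsto_integral_monomial {𝓕 : Set C(K, ℝ)}
    (h_gen : Dense (Submodule.span ℝ 𝓕 : Set C(K, ℝ))) {ι : Type*} {l : Filter ι}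
    {μ : ι → ProbabilityMeasure (LInfty r K)} {ν : ProbabilityMeasure (LInfty r K)}
    (h : ∀ k, 0 < k → ∀ a : (Fin r ↪ Fin k) → C(K, ℝ), (∀ e, a e ∈ 𝓕) →
      Tendsto (fun i => ∫ H, monomial a H ∂(μ i : Measure (LInfty r K))) l
        (𝓝 (∫ H, monomial a H ∂(ν : Measure (LInfty r K))))) :
    Tendsto μ l (𝓝 ν) := by
  refine le_nhds_of_unique_clusterPt fun ν' hν' => ?_
  obtain ⟨U, hU, hlim⟩ := mapClusterPt_iff_ultrafilter.1 hν'
  refine ProbabilityMeasure.toMeasure_injective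
    (ext_of_integral_monomial_of_dense h_gen fun k hk a ha => ?_)
  exact tendsto_nhds_unique (((continuous_integral_law (monomial a)).tendsto ν').comp hlim)
    ((h k hk a ha).mono_left hU)

theorem exists_tendsto_of_tendsto_integral_monomial {𝓕 : Set C(K, ℝ)}
    (h_gen : Dense (Submodule.span ℝ 𝓕 : Set C(K, ℝ))) {ι : Type*} {l : Filter ι} [l.NeBot]
    {μ : ι → ProbabilityMeasure (LInfty r K)}
    (h : ∀ k, 0 < k → ∀ a : (Fin r ↪ Fin k) → C(K, ℝ), (∀ e, a e ∈ 𝓕) →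
      ∃ m, Tendsto (fun i => ∫ H, monomial a H ∂(μ i : Measure (LInfty r K))) l (𝓝 m)) :
    ∃ ν, Tendsto μ l (𝓝 ν) := by
  obtain ⟨ν, hν⟩ := exists_clusterPt_of_compactSpace (map μ l)
  obtain ⟨U, hU, hlim⟩ := mapClusterPt_iff_ultrafilter.1 hν
  refine ⟨ν, tendsto_of_tendsto_integral_monomial h_gen fun k hk a ha => ?_⟩
  obtain ⟨m, hm⟩ := h k hk a ha
  rwa [tendsto_nhds_unique (((continuous_integral_law (monomial a)).tendsto ν).comp hlim)
    (hm.mono_left hU)]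

end Determinacy

/-! ### Continuity of densities for a fixed number of vertices -/

section Continuity

variable {K : Type*} [TopologicalSpace K] {r : ℕ}

/-- Whether `φ ∘ e` hits the diagonal does not depend on the decorations `A`: each factor is either
an evaluation or the constant `c (F.arr e)`. Nothing is needed of `c`. -/
theorem Labeled.continuous_homProd (c : C(K, ℝ) → ℝ) (F : Labeled r C(K, ℝ)) {n : ℕ}
    (hn : 0 < n) (φ : Fin F.n → Fin n) :
    Continuous fun A : (Fin r ↪ Fin n) → K => homProd c F ⟨n, hn, A⟩ φ := by
  simp_rw [homProd_eq_prod_embedding]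
  refine continuous_finsetProd _ fun e _ => ?_
  by_cases h : Function.Injective (φ ∘ e)
  · have : (fun A : (Fin r ↪ Fin n) → K =>
        factor c (some (F.arr e)) (entry ⟨n, hn, A⟩ (φ ∘ e))) =
        fun A => F.arr e (A ⟨φ ∘ e, h⟩) := by
      ext A
      rw [entry_of_injective _ h]
      rfl
    rw [this]
    fun_prop
  · have : (fun A : (Fin r ↪ Fin n) → K =>
        factor c (some (F.arr e)) (entry ⟨n, hn, A⟩ (φ ∘ e))) = fun _ => c (F.arr e) := by
      ext A
      have : entry ⟨n, hn, A⟩ (φ ∘ e) = none := dif_neg h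
      rw [this]
      rfl
    rw [this]
    fun_prop

theorem Labeled.continuous_t (c : C(K, ℝ) → ℝ) (F : Labeled r C(K, ℝ)) {n : ℕ} (hn : 0 < n) :
    Continuous fun A : (Fin r ↪ Fin n) → K => t c F ⟨n, hn, A⟩ := by
  have h : Continuous fun A : (Fin r ↪ Fin n) → K =>
      (∑ φ : Fin F.n → Fin n, homProd c F ⟨n, hn, A⟩ φ) / (n : ℝ) ^ F.n :=
    (continuous_finsetSum _ fun φ _ => continuous_homProd c F hn φ).div_const _
  exact h

theorem continuous_tauPlus_mk (c : C(K, ℝ) → ℝ) (𝓕 : Set C(K, ℝ)) {n : ℕ} (hn : 0 < n) :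
    Continuous fun A : (Fin r ↪ Fin n) → K =>
      tauPlus r c 𝓕 (Quotient.mk (Labeled.setoid r K) ⟨n, hn, A⟩) := by
  refine Continuous.prodMk (continuous_pi fun F => ?_) (continuous_const (y := 1 / (n : ℝ)))
  induction F using Quotient.inductionOn with
  | h F => exact Labeled.continuous_t c (F.map Subtype.val) hn

/-- The restriction of an infinite hypergraph to `[n]`, as an array. -/
def restrictArr (n : ℕ) (H : LInfty r K) : (Fin r ↪ Fin n) → K :=
  fun e => H (e.trans Fin.valEmbedding)

theorem continuous_restrictArr (n : ℕ) : Continuous (restrictArr n : LInfty r K → _) :=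
  continuous_pi fun _ => continuous_apply _

end Continuity

/-! ### Expected densities of exchangeable hypergraphs -/

section Exchangeable

theorem abs_integral_le_of_forall_abs_le {Y : Type*} [MeasurableSpace Y] {μ : Measure Y}
    [IsProbabilityMeasure μ] {f : Y → ℝ} {C : ℝ} (h : ∀ y, |f y| ≤ C) : |∫ y, f y ∂μ| ≤ C := by
  simpa using norm_integral_le_of_norm_le_const (μ := μ) (f := f) (.of_forall h)

/-- This turns invariance under finitary permutations into invariance under injections [k] → [n]. -/
theorem exists_perm_extending {k n : ℕ} (φ : Fin k ↪ Fin n) :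
    ∃ ρ : Equiv.Perm ℕ, {i | ρ i ≠ i}.Finite ∧ ∀ i : Fin k, ρ i = φ i := by
  classical
  have hkn : k ≤ n := by simpa using Fintype.card_le_of_embedding φ
  let e : {x // x ∈ Set.range (Fin.castLE hkn)} ≃ {x // x ∈ Set.range φ} :=
    (Equiv.ofInjective _ (Fin.castLE_injective hkn)).symm.trans (Equiv.ofInjective _ φ.injective)
  let σ : Equiv.Perm (Fin n) := e.extendSubtype
  have hσ : ∀ i, σ (Fin.castLE hkn i) = φ i := fun i => by
    have h := e.extendSubtype_apply_of_mem (Fin.castLE hkn i) ⟨i, rfl⟩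
    change e.extendSubtype _ = _
    rw [h]
    change ((Equiv.ofInjective _ φ.injective)
      ((Equiv.ofInjective _ (Fin.castLE_injective hkn)).symm ⟨Fin.castLE hkn i, i, rfl⟩) : Fin n) = _
    rw [Equiv.ofInjective_symm_apply (Fin.castLE_injective hkn)]
    rfl
  refine ⟨σ.extendDomain (Fin.equivSubtype (n := n)), (Set.finite_lt_nat n).subset fun i hi => ?_,
    fun i => ?_⟩
  · by_contra h
    exact hi (Equiv.Perm.extendDomain_apply_not_subtype _ _ h)
  · have h := Equiv.Perm.extendDomain_apply_image σ (Fin.equivSubtype (n := n)) (Fin.castLE hkn i)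
    rw [hσ] at h
    exact h

variable {K : Type*} [TopologicalSpace K] [PolishSpace K] [CompactSpace K] [MeasurableSpace K]
  [BorelSpace K] {r : ℕ}

theorem LInfty.measurable_permute {S : Type*} [MeasurableSpace S] (ρ : Equiv.Perm ℕ) :
    Measurable (LInfty.permute ρ : LInfty r S → LInfty r S) :=
  measurable_pi_lambda _ fun _ => measurable_pi_apply _

omit [CompactSpace K] in
theorem integral_prod_embedding {ν : Measure (LInfty r K)} (hν : ν ∈ exchangeableLaws r K)
    {k n : ℕ} (φ : Fin k ↪ Fin n) (a : (Fin r ↪ Fin k) → C(K, ℝ)) :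
    ∫ H, ∏ e, a e (restrictArr n H (e.trans φ)) ∂ν = ∫ H, monomial a H ∂ν := by
  obtain ⟨ρ, hρ, hφ⟩ := exists_perm_extending φ
  conv_rhs => rw [← hν.2 ρ hρ]
  rw [integral_map (LInfty.measurable_permute ρ).aemeasurable
    (monomial a).continuous.aestronglyMeasurable]
  refine integral_congr_ae (.of_forall fun H => ?_)
  simp only [monomial_apply]
  refine Finset.prod_congr rfl fun e _ => ?_
  refine congrArg (fun i => a e (H i)) (DFunLike.ext _ _ fun x => ?_)
  exact (hφ (e x)).symm

omit [CompactSpace K] in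
theorem integral_homProd {ν : Measure (LInfty r K)} (hν : ν ∈ exchangeableLaws r K)
    (c : C(K, ℝ) → ℝ) (F : Labeled r C(K, ℝ)) {n : ℕ} (hn : 0 < n) (φ : Fin F.n → Fin n)
    (hφ : Function.Injective φ) :
    ∫ H, Labeled.homProd c F ⟨n, hn, restrictArr n H⟩ φ ∂ν = ∫ H, monomial F.arr H ∂ν := by
  rw [← integral_prod_embedding hν ⟨φ, hφ⟩]
  refine integral_congr_ae (.of_forall fun H => ?_)
  exact Labeled.homProd_of_injective c F ⟨n, hn, restrictArr n H⟩ hφ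

theorem integrable_homProd {ν : Measure (LInfty r K)} [IsProbabilityMeasure ν]
    (c : C(K, ℝ) → ℝ) (F : Labeled r C(K, ℝ)) {n : ℕ} (hn : 0 < n) (φ : Fin F.n → Fin n) :
    Integrable (fun H : LInfty r K => Labeled.homProd c F ⟨n, hn, restrictArr n H⟩ φ) ν :=
  integrable_of_continuousMap
    ⟨_, (Labeled.continuous_homProd c F hn φ).comp (continuous_restrictArr n)⟩ ν

/-- The moments of an exchangeable law are the expected injective densities. -/
theorem integral_tInj {ν : Measure (LInfty r K)} (hν : ν ∈ exchangeableLaws r K)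
    (c : C(K, ℝ) → ℝ) (F : Labeled r C(K, ℝ)) :
    ∫ H, Labeled.tInj c F ⟨F.n, F.pos, restrictArr F.n H⟩ ∂ν = ∫ H, monomial F.arr H ∂ν := by
  have := hν.1
  have hne : (Fintype.card (Fin F.n ↪ Fin F.n) : ℝ) ≠ 0 :=
    Nat.cast_ne_zero.2 (Fintype.card_pos_iff.2 ⟨Function.Embedding.refl _⟩).ne'
  change ∫ H, (∑ φ : Fin F.n ↪ Fin F.n, Labeled.homProd c F ⟨F.n, F.pos, restrictArr F.n H⟩ φ) /
    (Fintype.card (Fin F.n ↪ Fin F.n) : ℝ) ∂ν = _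
  rw [integral_div, integral_finsetSum _ fun (φ : Fin F.n ↪ Fin F.n) _ =>
    integrable_homProd c F F.pos φ]
  rw [Finset.sum_congr rfl fun (φ : Fin F.n ↪ Fin F.n) _ =>
    integral_homProd hν c F F.pos φ φ.injective]
  rw [Finset.sum_const, nsmul_eq_mul, Finset.card_univ, mul_div_cancel_left₀ _ hne]

theorem integral_tInj_restrict {ν : Measure (LInfty r K)} (hν : ν ∈ exchangeableLaws r K)
    (c : C(K, ℝ) → ℝ) (F : Unlabeled r C(K, ℝ)) :
    ∫ H, tInj c F (LInfty.restrict F.size F.size_pos H) ∂ν =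
      ∫ H, monomial F.out.arr H ∂ν := by
  have h : F = Quotient.mk _ F.out := F.out_eq.symm
  rw [← integral_tInj hν c F.out]
  conv_lhs => rw [h]
  rfl

/-- By exchangeability every injective `φ` has the same expected product, namely the monomial
integral; only collisions contribute to the error. -/
theorem abs_integral_t_sub_le {ν : Measure (LInfty r K)} (hν : ν ∈ exchangeableLaws r K)
    (c : C(K, ℝ) → ℝ) (F : Labeled r C(K, ℝ)) {n : ℕ} (hn : 0 < n) :
    |∫ H, Labeled.t c F ⟨n, hn, restrictArr n H⟩ ∂ν - ∫ H, monomial F.arr H ∂ν| ≤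
      2 * F.bound c * collision F.n n := by
  have := hν.1
  have hpos : ((n : ℝ) ^ F.n) ≠ 0 := pow_ne_zero _ (by exact_mod_cast hn.ne')
  have h1 : ∫ H, Labeled.t c F ⟨n, hn, restrictArr n H⟩ ∂ν =
      (∑ φ : Fin F.n → Fin n, ∫ H, Labeled.homProd c F ⟨n, hn, restrictArr n H⟩ φ ∂ν) /
        (n : ℝ) ^ F.n := by
    change ∫ H, (∑ φ : Fin F.n → Fin n, Labeled.homProd c F ⟨n, hn, restrictArr n H⟩ φ) /
      (n : ℝ) ^ F.n ∂ν = _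
    rw [integral_div, integral_finsetSum _ fun (φ : Fin F.n → Fin n) _ =>
      integrable_homProd c F hn φ]
  -- The integral is written as an average of a constant over `φ`, to be compared term by term.
  have h2 : ∫ H, monomial F.arr H ∂ν =
      (∑ _φ : Fin F.n → Fin n, ∫ H, monomial F.arr H ∂ν) / (n : ℝ) ^ F.n := by
    rw [Finset.sum_const, nsmul_eq_mul, Finset.card_univ, Fintype.card_fun, Fintype.card_fin,
      Fintype.card_fin, Nat.cast_pow, mul_div_cancel_left₀ _ hpos]
  rw [h1]
  conv_lhs => rw [h2]
  refine abs_average_sub_average_le hn (fun φ => ?_) fun φ hφ => integral_homProd hν c F hn φ hφ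
  have h3 : |∫ H, Labeled.homProd c F ⟨n, hn, restrictArr n H⟩ φ ∂ν| ≤ F.bound c := by
    refine abs_integral_le_of_forall_abs_le fun H => ?_
    exact F.abs_homProd_le c ⟨n, hn, restrictArr n H⟩ φ
  have h4 : |∫ H, monomial F.arr H ∂ν| ≤ F.bound c := by
    refine abs_integral_le_of_forall_abs_le fun H => ?_
    rw [monomial_apply]
    exact (abs_prod_apply_le F.arr _).trans (F.prod_norm_le_bound c)
  exact (abs_sub _ _).trans (by linarith)

theorem tendsto_integral_t {ν : Measure (LInfty r K)} (hν : ν ∈ exchangeableLaws r K)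
    (c : C(K, ℝ) → ℝ) (F : Labeled r C(K, ℝ)) :
    Tendsto (fun n : ℕ => ∫ H, Labeled.t c F ⟨n + 1, n.succ_pos, restrictArr (n + 1) H⟩ ∂ν) atTop
      (𝓝 (∫ H, monomial F.arr H ∂ν)) := by
  rw [tendsto_iff_norm_sub_tendsto_zero]
  refine squeeze_zero (fun _ => norm_nonneg _)
    (fun n => abs_integral_t_sub_le hν c F n.succ_pos) ?_
  have h := ((tendsto_collision F.n).comp (tendsto_add_atTop_nat 1)).const_mul (2 * F.bound c)
  rw [mul_zero] at h
  exact h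

end Exchangeable

theorem countable_unlabeled (r : ℕ) {S : Type*} [Countable S] : Countable (Unlabeled r S) := by
  have : Countable (Labeled r S) := by
    refine Function.Injective.countable
      (f := fun G : Labeled r S => (⟨G.n, G.arr⟩ : Σ n : ℕ, (Fin r ↪ Fin n) → S)) ?_
    rintro ⟨n, hn, A⟩ ⟨m, hm, B⟩ h
    obtain ⟨rfl, h⟩ := Sigma.mk.inj_iff.1 h
    obtain rfl : A = B := eq_of_heq h
    rfl
  exact Quotient.countable

/-! ### Topology of the space of limit points -/

section LimitSpace

variable {K : Type*} [TopologicalSpace K] [CompactSpace K] {r : ℕ} {c : C(K, ℝ) → ℝ}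
  {𝓕 : Set C(K, ℝ)}

theorem isCompact_closure_piPlus : IsCompact (closure (PiPlus r c 𝓕)) := by
  refine IsCompact.closure_of_subset (K := (Set.univ.pi fun F : Unlabeled r 𝓕 =>
    Set.Icc (-((F.map Subtype.val).out.bound c)) ((F.map Subtype.val).out.bound c)) ×ˢ
      Set.Icc (0 : ℝ) 1) ((isCompact_univ_pi fun _ => isCompact_Icc).prod isCompact_Icc) ?_
  rintro _ ⟨G, rfl⟩
  refine ⟨fun F _ => ?_, one_div_nonneg.2 (Nat.cast_nonneg _), ?_⟩
  · rw [Set.mem_Icc, ← abs_le]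
    have h' : t c (F.map Subtype.val) G = Labeled.t c (F.map Subtype.val).out G.out := by
      conv_lhs => rw [← (F.map Subtype.val).out_eq, ← G.out_eq]
      rfl
    change |t c (F.map Subtype.val) G| ≤ _
    exact h'.symm ▸ Labeled.abs_t_le _ _ _
  · have : (1 : ℝ) ≤ G.size := by exact_mod_cast G.size_pos
    exact div_le_one_of_le₀ this (by positivity)

/-- The hypergraphs of a given size have a closed image. -/
theorem isClosed_image_size (n : ℕ) :
    IsClosed (tauPlus r c 𝓕 '' {G : Unlabeled r K | G.size = n}) := by
  rcases Nat.eq_zero_or_pos n with rfl | hn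
  · have : {G : Unlabeled r K | G.size = 0} = ∅ :=
      Set.eq_empty_of_forall_notMem fun G hG => G.size_pos.ne' hG
    rw [this, Set.image_empty]
    exact isClosed_empty
  · have : tauPlus r c 𝓕 '' {G : Unlabeled r K | G.size = n} =
        Set.range fun A : (Fin r ↪ Fin n) → K =>
          tauPlus r c 𝓕 (Quotient.mk (Labeled.setoid r K) ⟨n, hn, A⟩) := by
      ext z
      constructor
      · rintro ⟨G, hG, rfl⟩
        induction G using Quotient.inductionOn with
        | h G =>
          obtain ⟨m, hm, A⟩ := G
          obtain rfl : m = n := hG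
          exact ⟨A, rfl⟩
      · rintro ⟨A, rfl⟩
        exact ⟨_, rfl, rfl⟩
    rw [this]
    exact (isCompact_range (continuous_tauPlus_mk c 𝓕 hn)).isClosed

omit [CompactSpace K] in
theorem neBot_nhdsTrace (Γ : LimitSpace r c 𝓕) : (nhdsTrace Γ).NeBot := by
  rw [nhdsTrace, comap_neBot_iff_frequently]
  exact mem_closure_iff_frequently.1 Γ.2.1

/-- The hypergraphs with fewer than N vertices have a closed image, which misses `Γ` because `Γ`
lies outside Π(K)⁺. Its complement is therefore a neighbourhood of `Γ`. -/
theorem tendsto_size_nhdsTrace (Γ : LimitSpace r c 𝓕) :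
    Tendsto Unlabeled.size (nhdsTrace Γ) atTop := by
  refine tendsto_atTop.2 fun N => ?_
  have hcl : IsClosed (⋃ n ∈ Finset.range N, tauPlus r c 𝓕 '' {G : Unlabeled r K | G.size = n}) :=
    (Finset.range N).finite_toSet.isClosed_biUnion fun n _ => isClosed_image_size n
  have hΓ : (Γ : (Unlabeled r 𝓕 → ℝ) × ℝ) ∉
      ⋃ n ∈ Finset.range N, tauPlus r c 𝓕 '' {G : Unlabeled r K | G.size = n} := by
    simp only [Set.mem_iUnion, not_exists]
    rintro n _ ⟨G, _, hG⟩
    exact Γ.2.2 ⟨G, hG⟩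
  have h := preimage_mem_comap (m := tauPlus r c 𝓕) (hcl.isOpen_compl.mem_nhds hΓ)
  filter_upwards [h] with G hG
  by_contra hlt
  refine hG ?_
  simp only [Set.mem_iUnion]
  exact ⟨G.size, Finset.mem_range.2 (not_le.1 hlt), G, rfl, rfl⟩

omit [CompactSpace K] in
theorem tendsto_tauPlus_nhdsTrace (Γ : LimitSpace r c 𝓕) :
    Tendsto (tauPlus r c 𝓕) (nhdsTrace Γ) (𝓝 Γ) := tendsto_comap

theorem limitSpace_snd (Γ : LimitSpace r c 𝓕) : Γ.1.2 = 0 := by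
  have := neBot_nhdsTrace Γ
  refine tendsto_nhds_unique ((continuous_snd.tendsto _).comp (tendsto_tauPlus_nhdsTrace Γ)) ?_
  exact tendsto_one_div_atTop_nhds_zero_nat.comp (tendsto_size_nhdsTrace Γ)

/-- This is what the coordinate 1/|V(G)| is for: it is positive on Π(K)⁺ and zero on X, so X is
closed, hence compact. -/
theorem limitSpace_eq :
    LimitSpace r c 𝓕 = closure (PiPlus r c 𝓕) ∩ Prod.snd ⁻¹' {0} := by
  ext z
  refine ⟨fun h => ⟨h.1, limitSpace_snd ⟨z, h⟩⟩, fun h => ⟨h.1, ?_⟩⟩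
  rintro ⟨G, rfl⟩
  have h0 : 1 / (G.size : ℝ) = 0 := h.2
  have : (0 : ℝ) < G.size := by exact_mod_cast G.size_pos
  exact (one_div_pos.2 this).ne' h0

theorem isClosed_limitSpace : IsClosed (LimitSpace r c 𝓕) := by
  rw [limitSpace_eq]
  exact isClosed_closure.inter (isClosed_singleton.preimage continuous_snd)

instance : CompactSpace (LimitSpace r c 𝓕) :=
  isCompact_iff_compactSpace.1
    (isCompact_closure_piPlus.of_isClosed_subset isClosed_limitSpace fun _ h => h.1)

omit [CompactSpace K] in
theorem borelSpace_limitSpace (h : 𝓕.Countable) : BorelSpace (LimitSpace r c 𝓕) := by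
  have : Countable 𝓕 := h.to_subtype
  have := countable_unlabeled r (S := 𝓕)
  infer_instance

theorem polishSpace_limitSpace (h : 𝓕.Countable) : PolishSpace (LimitSpace r c 𝓕) := by
  have : Countable 𝓕 := h.to_subtype
  have := countable_unlabeled r (S := 𝓕)
  exact isClosed_limitSpace.polishSpace

omit [CompactSpace K] in
theorem t_mk_eq_out (F : Labeled r C(K, ℝ)) (G : Unlabeled r K) :
    t c (Quotient.mk _ F) G = Labeled.t c F G.out := by
  conv_lhs => rw [← G.out_eq]
  rfl

omit [TopologicalSpace K] [CompactSpace K] in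
theorem Unlabeled.size_eq_out (G : Unlabeled r K) : G.size = G.out.n := by
  conv_lhs => rw [← G.out_eq]
  rfl

theorem tendsto_t_sub_density (x₀ : K) (F : Labeled r C(K, ℝ)) (Γ : LimitSpace r c 𝓕) :
    Tendsto (fun G => t c (Quotient.mk _ F) G - G.out.density x₀ F.arr) (nhdsTrace Γ) (𝓝 0) := by
  refine squeeze_zero_norm
    (a := fun G : Unlabeled r K => 2 * F.bound c * collision F.n G.size) (fun G => ?_) ?_
  · rw [t_mk_eq_out, Unlabeled.size_eq_out]
    exact Labeled.abs_t_sub_density_le c x₀ F G.out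
  · have h := ((tendsto_collision F.n).comp (tendsto_size_nhdsTrace Γ)).const_mul (2 * F.bound c)
    rw [mul_zero] at h
    exact h

theorem tendsto_density_coordinate (x₀ : K) {k : ℕ} (hk : 0 < k) (a : (Fin r ↪ Fin k) → 𝓕)
    (Γ : LimitSpace r c 𝓕) :
    Tendsto (fun G : Unlabeled r K => G.out.density x₀ fun e => (a e : C(K, ℝ))) (nhdsTrace Γ)
      (𝓝 (Γ.1.1 (Quotient.mk _ ⟨k, hk, a⟩))) := by
  have h1 := tendsto_t_sub_density x₀ ⟨k, hk, fun e => (a e : C(K, ℝ))⟩ Γ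
  have h2 : Tendsto (fun G : Unlabeled r K =>
      t c (Quotient.mk _ ⟨k, hk, fun e => (a e : C(K, ℝ))⟩) G) (nhdsTrace Γ)
      (𝓝 (Γ.1.1 (Quotient.mk _ ⟨k, hk, a⟩))) :=
    (((continuous_apply (Quotient.mk _ ⟨k, hk, a⟩ : Unlabeled r 𝓕)).comp
      continuous_fst).tendsto _).comp (tendsto_tauPlus_nhdsTrace Γ)
  simpa using h2.sub h1

end LimitSpace

/-! ### The exchangeable law of a limit point -/

section LimitLaw

variable {K : Type*} [TopologicalSpace K] [PolishSpace K] [CompactSpace K] [MeasurableSpace K]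
  [BorelSpace K] {r : ℕ} {c : C(K, ℝ) → ℝ} {𝓕 : Set C(K, ℝ)}

theorem exists_tendsto_sampleLaw (x₀ : K) (h_gen : Dense (Submodule.span ℝ 𝓕 : Set C(K, ℝ)))
    (Γ : LimitSpace r c 𝓕) :
    ∃ ν, Tendsto (fun G : Unlabeled r K => G.out.sampleLaw x₀) (nhdsTrace Γ) (𝓝 ν) := by
  have := neBot_nhdsTrace Γ
  refine exists_tendsto_of_tendsto_integral_monomial h_gen fun k hk a ha =>
    ⟨Γ.1.1 (Quotient.mk _ ⟨k, hk, fun e => ⟨a e, ha e⟩⟩), ?_⟩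
  simp_rw [Labeled.integral_sampleLaw_monomial]
  exact tendsto_density_coordinate x₀ hk (fun e => ⟨a e, ha e⟩) Γ

/-- The law of the infinite random hypergraph sampled from the limit point `Γ`. -/
def limitLaw [Nonempty K] (h_gen : Dense (Submodule.span ℝ 𝓕 : Set C(K, ℝ)))
    (Γ : LimitSpace r c 𝓕) : ProbabilityMeasure (LInfty r K) :=
  (exists_tendsto_sampleLaw (Classical.arbitrary K) h_gen Γ).choose

variable [Nonempty K] (h_gen : Dense (Submodule.span ℝ 𝓕 : Set C(K, ℝ)))

theorem tendsto_sampleLaw (Γ : LimitSpace r c 𝓕) :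
    Tendsto (fun G : Unlabeled r K => G.out.sampleLaw (Classical.arbitrary K)) (nhdsTrace Γ)
      (𝓝 (limitLaw h_gen Γ)) :=
  (exists_tendsto_sampleLaw (Classical.arbitrary K) h_gen Γ).choose_spec

theorem tendsto_density (Γ : LimitSpace r c 𝓕) {k : ℕ} (a : (Fin r ↪ Fin k) → C(K, ℝ)) :
    Tendsto (fun G : Unlabeled r K => G.out.density (Classical.arbitrary K) a) (nhdsTrace Γ)
      (𝓝 (∫ H, monomial a H ∂(limitLaw h_gen Γ : Measure (LInfty r K)))) := by
  simp_rw [← Labeled.integral_sampleLaw_monomial]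
  exact ((continuous_integral_law (monomial a)).tendsto _).comp (tendsto_sampleLaw h_gen Γ)

theorem tendsto_t_mk (Γ : LimitSpace r c 𝓕) (F : Labeled r C(K, ℝ)) :
    Tendsto (t c (Quotient.mk _ F)) (nhdsTrace Γ)
      (𝓝 (∫ H, monomial F.arr H ∂(limitLaw h_gen Γ : Measure (LInfty r K)))) := by
  have h := (tendsto_t_sub_density (Classical.arbitrary K) F Γ).add
    (tendsto_density h_gen Γ F.arr)
  simpa using h

theorem tLim_mk (Γ : LimitSpace r c 𝓕) (F : Labeled r C(K, ℝ)) :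
    tLim (Quotient.mk _ F) Γ =
      ∫ H, monomial F.arr H ∂(limitLaw h_gen Γ : Measure (LInfty r K)) := by
  have := neBot_nhdsTrace Γ
  exact (tendsto_t_mk h_gen Γ F).limUnder_eq

theorem tLim_eq_integral (Γ : LimitSpace r c 𝓕) (F : Unlabeled r C(K, ℝ)) :
    tLim F Γ = ∫ H, monomial F.out.arr H ∂(limitLaw h_gen Γ : Measure (LInfty r K)) := by
  rw [← tLim_mk h_gen]
  exact congrArg (fun F => tLim F Γ) F.out_eq.symm

include h_gen in
theorem tendsto_tLim (F : Unlabeled r C(K, ℝ)) (Γ : LimitSpace r c 𝓕) :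
    Tendsto (t c F) (nhdsTrace Γ) (𝓝 (tLim F Γ)) := by
  induction F using Quotient.inductionOn with
  | h F =>
    rw [tLim_mk h_gen]
    exact tendsto_t_mk h_gen Γ F

include h_gen in
theorem tLim_map_val (F : Unlabeled r 𝓕) (Γ : LimitSpace r c 𝓕) :
    tLim (F.map Subtype.val) Γ = Γ.1.1 F := by
  have := neBot_nhdsTrace Γ
  refine tendsto_nhds_unique (tendsto_tLim h_gen _ Γ) ?_
  exact (((continuous_apply F).comp continuous_fst).tendsto _).comp (tendsto_tauPlus_nhdsTrace Γ)

/-- For entries in 𝓕 the monomial integrals are coordinates of `Γ`, and these suffice for weak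
convergence. -/
theorem continuous_limitLaw :
    Continuous (limitLaw h_gen : LimitSpace r c 𝓕 → ProbabilityMeasure (LInfty r K)) := by
  refine continuous_iff_continuousAt.2 fun Γ => ?_
  refine tendsto_of_tendsto_integral_monomial h_gen fun k hk a ha => ?_
  have h : ∀ Γ : LimitSpace r c 𝓕,
      ∫ H, monomial a H ∂(limitLaw h_gen Γ : Measure (LInfty r K)) =
        Γ.1.1 (Quotient.mk _ ⟨k, hk, fun e => ⟨a e, ha e⟩⟩) := fun Γ => by
    exact (tLim_mk h_gen Γ ⟨k, hk, a⟩).symm.trans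
      (tLim_map_val h_gen (Quotient.mk _ ⟨k, hk, fun e => ⟨a e, ha e⟩⟩) Γ)
  simp_rw [h]
  exact ((continuous_apply _).comp (continuous_fst.comp continuous_subtype_val)).tendsto Γ

include h_gen in
theorem continuous_tLim (F : Unlabeled r C(K, ℝ)) :
    Continuous fun Γ : LimitSpace r c 𝓕 => tLim F Γ := by
  simp_rw [tLim_eq_integral h_gen]
  exact (continuous_integral_law _).comp (continuous_limitLaw h_gen)

/-- Invariance of the sampling laws passes to the weak limit, relabeling being continuous. -/
theorem limitLaw_mem (Γ : LimitSpace r c 𝓕) :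
    (limitLaw h_gen Γ : Measure (LInfty r K)) ∈ exchangeableLaws r K := by
  refine ⟨inferInstance, fun ρ _ => ?_⟩
  have := neBot_nhdsTrace Γ
  have hc : Continuous (LInfty.permute ρ : LInfty r K → LInfty r K) :=
    continuous_pi fun _ => continuous_apply _
  have h1 := ProbabilityMeasure.tendsto_map_of_tendsto_of_continuous _ _
    (tendsto_sampleLaw h_gen Γ) hc
  have h2 : ∀ G : Unlabeled r K, (G.out.sampleLaw (Classical.arbitrary K)).map
      hc.measurable.aemeasurable = G.out.sampleLaw (Classical.arbitrary K) := fun G =>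
    ProbabilityMeasure.toMeasure_injective (G.out.map_permute_sampleLaw _ ρ)
  simp_rw [h2] at h1
  exact (congrArg ProbabilityMeasure.toMeasure
    (tendsto_nhds_unique (tendsto_sampleLaw h_gen Γ) h1)).symm

theorem integral_limitLaw_disjointUnion (Γ : LimitSpace r c 𝓕) {k l : ℕ}
    (a : (Fin r ↪ Fin k) → C(K, ℝ)) (b : (Fin r ↪ Fin l) → C(K, ℝ)) :
    ∫ H, monomial (disjointUnion a b) H ∂(limitLaw h_gen Γ : Measure (LInfty r K)) =
      (∫ H, monomial a H ∂(limitLaw h_gen Γ : Measure (LInfty r K))) *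
        ∫ H, monomial b H ∂(limitLaw h_gen Γ : Measure (LInfty r K)) := by
  have := neBot_nhdsTrace Γ
  have h := (tendsto_density h_gen Γ a).mul (tendsto_density h_gen Γ b)
  simp_rw [← Labeled.density_disjointUnion] at h
  exact tendsto_nhds_unique (tendsto_density h_gen Γ _) h

end LimitLaw

/-! ### Mixtures of measures and extreme points -/

section Mixtures

/-- The mass of a closed set is a pointwise limit of integrals of continuous functions, and closed
sets form a π-system that generates the Borel sets. -/
theorem measurable_toMeasure_of_continuous {X Y : Type*} [TopologicalSpace X] [MeasurableSpace X]
    [OpensMeasurableSpace X] [TopologicalSpace Y] [MeasurableSpace Y] [BorelSpace Y]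
    [HasOuterApproxClosed Y] {f : X → ProbabilityMeasure Y} (hf : Continuous f) :
    Measurable fun x => (f x : Measure Y) := by
  refine Measurable.measure_of_isPiSystem_of_isProbabilityMeasure
    (S := {s | IsClosed s}) ?_ isPiSystem_isClosed fun s hs => ?_
  · rw [BorelSpace.measurable_eq (α := Y), borel_eq_generateFrom_isClosed]
  · refine measurable_of_tendsto_metrizable (f := fun n x => ∫⁻ y, hs.apprSeq n y ∂(f x : Measure Y))
      (fun n => ?_) (tendsto_pi_nhds.2 fun x =>
        HasOuterApproxClosed.tendsto_lintegral_apprSeq hs (f x : Measure Y))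
    exact ((ProbabilityMeasure.continuous_lintegral_boundedContinuousFunction
      (hs.apprSeq n)).comp hf).measurable

variable {X Y : Type*} [MeasurableSpace X] [MeasurableSpace Y] {κ : X → Measure Y}

theorem integral_bind_eq (hκ : Measurable κ) {P : Measure X} {f : Y → ℝ}
    (hf : Integrable f (P.bind κ)) : ∫ y, f y ∂(P.bind κ) = ∫ x, ∫ y, f y ∂κ x ∂P := by
  let η : ProbabilityTheory.Kernel X Y := ⟨κ, hκ⟩
  change Integrable f (P.bind η) at hf
  change ∫ y, f y ∂(P.bind η) = ∫ x, ∫ y, f y ∂η x ∂P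
  rw [Measure.comp_eq_comp_const_apply] at hf ⊢
  rw [ProbabilityTheory.Kernel.integral_comp hf, ProbabilityTheory.Kernel.const_apply]

theorem isProbabilityMeasure_bind_of_forall (hκ : Measurable κ)
    (h : ∀ x, IsProbabilityMeasure (κ x)) (P : Measure X) [IsProbabilityMeasure P] :
    IsProbabilityMeasure (P.bind κ) :=
  isProbabilityMeasure_bind hκ.aemeasurable (.of_forall h)

theorem bind_smul_add_smul (hκ : Measurable κ) (P Q : Measure X) (a b : ℝ≥0) :
    (a • P + b • Q).bind κ = a • P.bind κ + b • Q.bind κ := by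
  ext s hs
  simp only [Measure.bind_apply hs hκ.aemeasurable, Measure.add_apply, Measure.smul_apply,
    lintegral_add_measure, lintegral_smul_measure]

theorem isProbabilityMeasure_smul_add_smul {P Q : Measure X} [IsProbabilityMeasure P]
    [IsProbabilityMeasure Q] {a b : ℝ≥0} (h : a + b = 1) :
    IsProbabilityMeasure (a • P + b • Q) := by
  constructor
  simp only [Measure.add_apply, Measure.smul_apply, measure_univ, ENNReal.smul_def, smul_eq_mul,
    mul_one]
  exact_mod_cast h

theorem eq_dirac_of_ae_eq {P : Measure X} [IsProbabilityMeasure P] {x : X}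
    (h : ∀ᵐ y ∂P, y = x) : P = Measure.dirac x := by
  calc P = P.map id := Measure.map_id.symm
    _ = P.map fun _ => x := Measure.map_congr h
    _ = Measure.dirac x := by rw [Measure.map_const, measure_univ, one_smul]

/-- If every element of `E` is the mixture of the measures `κ x` for a unique mixing measure, then
the extreme points of `E` are the measures `κ x`. -/
theorem mem_extremePoints_iff_of_bind [StandardBorelSpace X] (hκ : Measurable κ)
    {E : Set (Measure Y)} (hmem : ∀ P : Measure X, IsProbabilityMeasure P → P.bind κ ∈ E)
    (hinj : ∀ P Q : Measure X, IsProbabilityMeasure P → IsProbabilityMeasure Q →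
      P.bind κ = Q.bind κ → P = Q)
    (hsurj : ∀ ν ∈ E, ∃ P : Measure X, IsProbabilityMeasure P ∧ P.bind κ = ν) {ν : Measure Y} :
    ν ∈ E.extremePoints ℝ≥0 ↔ ∃ x, κ x = ν := by
  rw [mem_extremePoints_iff_left]
  constructor
  · rintro ⟨hν, hext⟩
    obtain ⟨P, hP, rfl⟩ := hsurj ν hν
    -- Otherwise conditioning on `s` and on its complement splits `P` properly. Extremality and
    -- `hinj` then give `cond P s = P`, although `P` charges the complement of `s`.
    have : IsZeroOneMeasure P := by
      refine ⟨fun s hs => ?_⟩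
      by_contra! hcon
      have h0 : P s ≠ 0 := hcon.1
      have h0' : P sᶜ ≠ 0 := fun h => hcon.2 ((prob_compl_eq_zero_iff hs).1 h)
      have h1 : IsProbabilityMeasure (ProbabilityTheory.cond P s) :=
        ProbabilityTheory.cond_isProbabilityMeasure h0
      have h2 : IsProbabilityMeasure (ProbabilityTheory.cond P sᶜ) :=
        ProbabilityTheory.cond_isProbabilityMeasure h0'
      have hsum : (P s).toNNReal • ProbabilityTheory.cond P s +
          (P sᶜ).toNNReal • ProbabilityTheory.cond P sᶜ = P := by
        ext u _
        simp only [Measure.add_apply, Measure.smul_apply, ENNReal.smul_def, smul_eq_mul,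
          ENNReal.coe_toNNReal (measure_ne_top P _)]
        rw [mul_comm, mul_comm (P sᶜ)]
        exact ProbabilityTheory.cond_add_cond_compl_eq hs P
      have hab : (P s).toNNReal + (P sᶜ).toNNReal = 1 := by
        rw [← ENNReal.toNNReal_add (measure_ne_top P _) (measure_ne_top P _),
          measure_add_measure_compl hs, measure_univ, ENNReal.toNNReal_one]
      have h := hext _ (hmem _ h1) _ (hmem _ h2)
        ⟨(P s).toNNReal, (P sᶜ).toNNReal, ENNReal.toNNReal_pos h0 (measure_ne_top P _),
          ENNReal.toNNReal_pos h0' (measure_ne_top P _), hab, by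
          rw [← bind_smul_add_smul hκ, hsum]⟩
      have h3 := hinj _ _ h1 hP h
      refine h0' ?_
      rw [← h3, ProbabilityTheory.cond_apply hs]
      simp
    obtain ⟨x, hx⟩ := IsZeroOneMeasure.exists_eq_dirac (μ := P)
    exact ⟨x, by rw [hx, Measure.dirac_bind hκ]⟩
  · rintro ⟨x, rfl⟩
    have hd : (Measure.dirac x).bind κ = κ x := Measure.dirac_bind hκ x
    refine ⟨hd ▸ hmem _ inferInstance, ?_⟩
    rintro ν₁ hν₁ ν₂ hν₂ ⟨a, b, ha, hb, hab, h⟩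
    obtain ⟨P, hP, rfl⟩ := hsurj ν₁ hν₁
    obtain ⟨Q, hQ, rfl⟩ := hsurj ν₂ hν₂
    rw [← bind_smul_add_smul hκ, ← hd] at h
    have h' := hinj _ _ (isProbabilityMeasure_smul_add_smul hab) inferInstance h
    -- A proper convex combination that equals the Dirac mass at `x` has both components
    -- concentrated at `x`.
    have h0 : P {x}ᶜ = 0 := by
      have h1 := congrArg (fun μ : Measure X => μ {x}ᶜ) h'
      simp only [Measure.add_apply, Measure.smul_apply] at h1
      rw [Measure.dirac_apply' _ (measurableSet_singleton x).compl] at h1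
      have h2 : a • P {x}ᶜ = 0 := (add_eq_zero.1 (h1.trans (by simp))).1
      rw [ENNReal.smul_def, smul_eq_mul] at h2
      exact (mul_eq_zero.1 h2).resolve_left (by exact_mod_cast ha.ne')
    rw [eq_dirac_of_ae_eq (P := P) (x := x) (by rw [ae_iff]; exact h0), hd]

end Mixtures

/-! ### Injectivity of the mixture map -/

section Representation

variable {K : Type*} [TopologicalSpace K] [PolishSpace K] [CompactSpace K] [MeasurableSpace K]
  [BorelSpace K] {r : ℕ} {c : C(K, ℝ) → ℝ} {𝓕 : Set C(K, ℝ)} [Nonempty K]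
  (h_countable : 𝓕.Countable) (h_gen : Dense (Submodule.span ℝ 𝓕 : Set C(K, ℝ)))

include h_countable in
theorem measurable_limitLaw :
    Measurable fun Γ : LimitSpace r c 𝓕 => (limitLaw h_gen Γ : Measure (LInfty r K)) := by
  have := borelSpace_limitSpace (r := r) (c := c) h_countable
  exact measurable_toMeasure_of_continuous (continuous_limitLaw h_gen)

/-- The law of the infinite random hypergraph sampled from a random limit point. -/
def mixture (P : Measure (LimitSpace r c 𝓕)) : Measure (LInfty r K) :=
  P.bind fun Γ => (limitLaw h_gen Γ : Measure (LInfty r K))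

include h_countable in
theorem mixture_mem (P : Measure (LimitSpace r c 𝓕)) [IsProbabilityMeasure P] :
    mixture h_gen P ∈ exchangeableLaws r K := by
  refine ⟨isProbabilityMeasure_bind_of_forall (measurable_limitLaw h_countable h_gen)
    (fun Γ => inferInstance) P, fun ρ hρ => ?_⟩
  ext s hs
  have hm := (measurable_limitLaw (r := r) (c := c) h_countable h_gen).aemeasurable (μ := P)
  have hp : Measurable (LInfty.permute ρ : LInfty r K → LInfty r K) := LInfty.measurable_permute ρ
  rw [Measure.map_apply hp hs, mixture, Measure.bind_apply hs hm, Measure.bind_apply (hp hs) hm]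
  refine lintegral_congr fun Γ => ?_
  rw [← Measure.map_apply hp hs, (limitLaw_mem h_gen Γ).2 ρ hρ]

include h_countable in
theorem integral_mixture_monomial (P : Measure (LimitSpace r c 𝓕)) [IsProbabilityMeasure P]
    (F : Labeled r C(K, ℝ)) :
    ∫ H, monomial F.arr H ∂(mixture h_gen P) = ∫ Γ, tLim (Quotient.mk _ F) Γ ∂P := by
  have := (mixture_mem h_countable h_gen P).1
  simp_rw [tLim_mk h_gen]
  exact integral_bind_eq (measurable_limitLaw h_countable h_gen)
    (integrable_of_continuousMap (monomial F.arr) (mixture h_gen P))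

/-- The density as a bounded continuous function of the limit point. -/
def tLimBCF (F : Labeled r C(K, ℝ)) : BoundedContinuousFunction (LimitSpace r c 𝓕) ℝ :=
  .mkOfCompact ⟨fun Γ => tLim (Quotient.mk _ F) Γ, continuous_tLim h_gen _⟩

theorem tLimBCF_apply (F : Labeled r C(K, ℝ)) (Γ : LimitSpace r c 𝓕) :
    tLimBCF h_gen F Γ = ∫ H, monomial F.arr H ∂(limitLaw h_gen Γ : Measure (LInfty r K)) :=
  tLim_mk h_gen Γ F

/-- The densities, as a multiplicative set of functions of the limit point. -/
def densityMonoid : Submonoid (BoundedContinuousFunction (LimitSpace r c 𝓕) ℝ) where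
  carrier := Set.range (tLimBCF h_gen)
  mul_mem' := by
    rintro _ _ ⟨F, rfl⟩ ⟨F', rfl⟩
    refine ⟨⟨F.n + F'.n, Nat.add_pos_left F.pos _, disjointUnion F.arr F'.arr⟩, ?_⟩
    ext Γ
    rw [BoundedContinuousFunction.mul_apply, tLimBCF_apply, tLimBCF_apply, tLimBCF_apply]
    exact integral_limitLaw_disjointUnion h_gen Γ F.arr F'.arr
  one_mem' := by
    -- A single vertex decorated by 1: the product is 1, whether it is empty (r ≥ 2) or not.
    refine ⟨⟨1, one_pos, fun _ => 1⟩, ?_⟩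
    ext Γ
    rw [tLimBCF_apply]
    simp

include h_countable h_gen in
/-- The expected densities determine the law of a random limit point. -/
theorem ext_of_integral_tLim {P Q : Measure (LimitSpace r c 𝓕)} [IsProbabilityMeasure P]
    [IsProbabilityMeasure Q]
    (h : ∀ F : Labeled r C(K, ℝ), ∫ Γ : LimitSpace r c 𝓕, tLim (Quotient.mk _ F) Γ ∂P =
      ∫ Γ, tLim (Quotient.mk _ F) Γ ∂Q) : P = Q := by
  have := borelSpace_limitSpace (r := r) (c := c) h_countable
  have := polishSpace_limitSpace (r := r) (c := c) h_countable
  let M := densityMonoid (r := r) (c := c) h_gen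
  let A : StarSubalgebra ℝ (BoundedContinuousFunction (LimitSpace r c 𝓕) ℝ) :=
    { Algebra.adjoin ℝ (M : Set (BoundedContinuousFunction (LimitSpace r c 𝓕) ℝ)) with
      star_mem' := fun {f} hf => by
        rwa [show star f = f from BoundedContinuousFunction.ext fun _ => star_trivial _] }
  refine ext_of_forall_mem_subalgebra_integral_eq_of_polish (A := A) ?_ fun g hg => ?_
  · intro Γ Γ' hne
    -- Separation of points: the last coordinates are both 0, so the two points differ in a density.
    obtain ⟨F, hF⟩ : ∃ F, Γ.1.1 F ≠ Γ'.1.1 F := by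
      by_contra! hcon
      exact hne (Subtype.ext (Prod.ext (funext hcon)
        ((limitSpace_snd Γ).trans (limitSpace_snd Γ').symm)))
    rw [← tLim_map_val h_gen, ← tLim_map_val h_gen] at hF
    refine ⟨_, ⟨_, ⟨tLimBCF h_gen (F.map Subtype.val).out, Algebra.subset_adjoin ⟨_, rfl⟩, rfl⟩,
      rfl⟩, ?_⟩
    have h' : ∀ Γ : LimitSpace r c 𝓕, tLimBCF h_gen (F.map Subtype.val).out Γ =
        tLim (F.map Subtype.val) Γ := fun Γ => by
      rw [tLimBCF_apply, tLim_eq_integral h_gen]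
    change tLimBCF h_gen (F.map Subtype.val).out Γ ≠ tLimBCF h_gen (F.map Subtype.val).out Γ'
    rwa [h', h']
  · have hg' : g ∈ Subalgebra.toSubmodule (Algebra.adjoin ℝ
        (M : Set (BoundedContinuousFunction (LimitSpace r c 𝓕) ℝ))) := hg
    rw [Algebra.adjoin_eq_span, Submonoid.closure_eq] at hg'
    clear hg
    induction hg' using Submodule.span_induction with
    | mem g hg =>
      obtain ⟨F, rfl⟩ := hg
      exact h F
    | zero => simp
    | add f g _ _ hf hg =>
      simp only [BoundedContinuousFunction.add_apply]
      rw [integral_add (f.integrable P) (g.integrable P),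
        integral_add (f.integrable Q) (g.integrable Q), hf, hg]
    | smul s f _ hf =>
      simp only [BoundedContinuousFunction.smul_apply, integral_smul, hf]

include h_countable in
theorem mixture_injective {P Q : Measure (LimitSpace r c 𝓕)} [IsProbabilityMeasure P]
    [IsProbabilityMeasure Q] (h : mixture h_gen P = mixture h_gen Q) : P = Q :=
  ext_of_integral_tLim h_countable h_gen fun F => by
    rw [← integral_mixture_monomial h_countable h_gen,
      ← integral_mixture_monomial h_countable h_gen, h]

end Representation

/-! ### Surjectivity of the mixture map -/

section Surjectivity

variable {K : Type*} [TopologicalSpace K] [PolishSpace K] [CompactSpace K] [MeasurableSpace K]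
  [BorelSpace K] {r : ℕ} {c : C(K, ℝ) → ℝ} {𝓕 : Set C(K, ℝ)}

/-- The point of the closure of `Π(K)⁺` given by the restriction to `[n + 1]`. -/
def restrictPoint (c : C(K, ℝ) → ℝ) (𝓕 : Set C(K, ℝ)) (n : ℕ) (H : LInfty r K) :
    closure (PiPlus r c 𝓕) :=
  ⟨tauPlus r c 𝓕 (LInfty.restrict (n + 1) n.succ_pos H), subset_closure ⟨_, rfl⟩⟩

omit [PolishSpace K] [CompactSpace K] [MeasurableSpace K] [BorelSpace K] in
theorem continuous_restrictPoint (n : ℕ) :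
    Continuous (restrictPoint c 𝓕 n : LInfty r K → closure (PiPlus r c 𝓕)) :=
  Continuous.subtype_mk
    ((continuous_tauPlus_mk c 𝓕 n.succ_pos).comp (continuous_restrictArr (n + 1))) _

/-- The measure is a weak cluster point of the laws of τ⁺(H|_[n+1]). Each coordinate is continuous
and its expectation converges, so the expectation under the cluster point is the limit. -/
theorem exists_measure_integral_coordinate (h_countable : 𝓕.Countable) {ν : Measure (LInfty r K)}
    (hν : ν ∈ exchangeableLaws r K) :
    ∃ P : Measure (LimitSpace r c 𝓕), IsProbabilityMeasure P ∧
      ∀ F : Labeled r 𝓕, ∫ Γ, Γ.1.1 (Quotient.mk _ F) ∂P =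
        ∫ H, monomial (F.map Subtype.val).arr H ∂ν := by
  have := hν.1
  have : Countable 𝓕 := h_countable.to_subtype
  have := countable_unlabeled r (S := 𝓕)
  let Y := closure (PiPlus r c 𝓕)
  have : CompactSpace Y := isCompact_iff_compactSpace.1 isCompact_closure_piPlus
  let Q : ℕ → ProbabilityMeasure Y := fun n =>
    ⟨ν.map (restrictPoint c 𝓕 n),
      Measure.isProbabilityMeasure_map (continuous_restrictPoint n).measurable.aemeasurable⟩
  have hQ : ∀ (n : ℕ) (g : C(Y, ℝ)), ∫ y, g y ∂(Q n : Measure Y) =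
      ∫ H, g (restrictPoint c 𝓕 n H) ∂ν := fun n g =>
    integral_map (continuous_restrictPoint n).measurable.aemeasurable
      g.continuous.aestronglyMeasurable
  obtain ⟨R, hR⟩ := exists_clusterPt_of_compactSpace (map Q atTop)
  obtain ⟨U, hU, hlim⟩ := mapClusterPt_iff_ultrafilter.1 hR
  have key : ∀ (g : C(Y, ℝ)) (m : ℝ),
      Tendsto (fun n => ∫ H, g (restrictPoint c 𝓕 n H) ∂ν) atTop (𝓝 m) →
      ∫ y, g y ∂(R : Measure Y) = m := fun g m hm => by
    simp_rw [← hQ] at hm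
    exact tendsto_nhds_unique (((continuous_integral_law g).tendsto R).comp hlim) (hm.mono_left hU)
  have hcoord : ∀ F : Labeled r 𝓕, ∫ y : Y, y.1.1 (Quotient.mk _ F) ∂(R : Measure Y) =
      ∫ H, monomial (F.map Subtype.val).arr H ∂ν := fun F =>
    key ⟨fun y : Y => y.1.1 (Quotient.mk _ F),
      (continuous_apply _).comp (continuous_fst.comp continuous_subtype_val)⟩ _
      (tendsto_integral_t hν c (F.map Subtype.val))
  have hsnd : ∫ y : Y, y.1.2 ∂(R : Measure Y) = 0 := by
    refine key ⟨fun y : Y => y.1.2, continuous_snd.comp continuous_subtype_val⟩ _ ?_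
    have h : ∀ n : ℕ, ∫ H : LInfty r K, (restrictPoint c 𝓕 n H).1.2 ∂ν = 1 / ((n : ℝ) + 1) :=
      fun n => by
        have : ∀ H : LInfty r K, (restrictPoint c 𝓕 n H).1.2 = 1 / (((n + 1 : ℕ) : ℕ) : ℝ) :=
          fun _ => rfl
        simp [this]
    refine Tendsto.congr (fun n => (h n).symm) ?_
    exact tendsto_one_div_add_atTop_nhds_zero_nat
  have hnonneg : ∀ y : Y, 0 ≤ y.1.2 := fun y => by
    have hcl : IsClosed {z : (Unlabeled r 𝓕 → ℝ) × ℝ | 0 ≤ z.2} :=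
      isClosed_le continuous_const continuous_snd
    refine closure_minimal ?_ hcl y.2
    rintro _ ⟨G, rfl⟩
    have : (0 : ℝ) ≤ 1 / (G.size : ℝ) := by positivity
    exact this
  -- A nonnegative last coordinate with mean lim 1/(n+1) = 0 vanishes almost surely, which places
  -- the cluster point on X.
  have hae : ∀ᵐ y : Y ∂(R : Measure Y), y.1 ∈ LimitSpace r c 𝓕 := by
    have h0 := (integral_eq_zero_iff_of_nonneg hnonneg (integrable_of_continuousMap
      ⟨fun y : Y => y.1.2, continuous_snd.comp continuous_subtype_val⟩ (R : Measure Y))).1 hsnd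
    filter_upwards [h0] with y hy
    rw [limitSpace_eq]
    exact ⟨y.2, hy⟩
  have hX : MeasurableSet (LimitSpace r c 𝓕) := isClosed_limitSpace.measurableSet
  -- The measure is moved from the closure to X through the ambient product space.
  let R' : Measure ((Unlabeled r 𝓕 → ℝ) × ℝ) := (R : Measure Y).map Subtype.val
  have hmap : (R'.comap (Subtype.val : LimitSpace r c 𝓕 → _)).map Subtype.val = R' := by
    rw [map_comap_subtype_coe hX]
    refine Measure.restrict_eq_self_of_ae_mem ?_
    exact (ae_map_iff measurable_subtype_coe.aemeasurable hX).2 hae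
  refine ⟨R'.comap Subtype.val, ⟨?_⟩, fun F => ?_⟩
  · rw [← Set.preimage_univ (f := (Subtype.val : LimitSpace r c 𝓕 → _)),
      ← Measure.map_apply measurable_subtype_coe MeasurableSet.univ, hmap,
      Measure.map_apply measurable_subtype_coe MeasurableSet.univ, Set.preimage_univ, measure_univ]
  · rw [← hcoord F]
    have hc : Continuous fun z : (Unlabeled r 𝓕 → ℝ) × ℝ => z.1 (Quotient.mk _ F) :=
      (continuous_apply _).comp continuous_fst
    rw [← integral_map (f := fun z : (Unlabeled r 𝓕 → ℝ) × ℝ => z.1 (Quotient.mk _ F))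
      measurable_subtype_coe.aemeasurable hc.aestronglyMeasurable, hmap]
    exact integral_map measurable_subtype_coe.aemeasurable hc.aestronglyMeasurable

variable [Nonempty K]

theorem mixture_surjective (h_countable : 𝓕.Countable)
    (h_gen : Dense (Submodule.span ℝ 𝓕 : Set C(K, ℝ))) {ν : Measure (LInfty r K)}
    (hν : ν ∈ exchangeableLaws r K) :
    ∃ P : Measure (LimitSpace r c 𝓕), IsProbabilityMeasure P ∧ mixture h_gen P = ν := by
  have := hν.1
  obtain ⟨P, hP, h⟩ := exists_measure_integral_coordinate (c := c) h_countable hν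
  have := (mixture_mem h_countable h_gen P).1
  refine ⟨P, hP, ext_of_integral_monomial_of_dense h_gen fun k hk a ha => ?_⟩
  let F : Labeled r 𝓕 := ⟨k, hk, fun e => ⟨a e, ha e⟩⟩
  refine (integral_mixture_monomial h_countable h_gen P (F.map Subtype.val)).trans ?_
  refine Eq.trans ?_ (h F)
  exact integral_congr_ae (.of_forall fun Γ => tLim_map_val h_gen (Quotient.mk _ F) Γ)

end Surjectivity

/-! ### The two correspondences and their characterizations -/

section Characterization

variable {K : Type*} [TopologicalSpace K] [PolishSpace K] [CompactSpace K] [MeasurableSpace K]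
  [BorelSpace K] {r : ℕ} {c : C(K, ℝ) → ℝ} {𝓕 : Set C(K, ℝ)}

/-- Exchangeable laws with the same expected injective densities are equal. -/
theorem ext_of_integral_tInj {μ ν : Measure (LInfty r K)} (hμ : μ ∈ exchangeableLaws r K)
    (hν : ν ∈ exchangeableLaws r K) (c : C(K, ℝ) → ℝ)
    (h : ∀ F : Unlabeled r C(K, ℝ),
      ∫ H, tInj c F (LInfty.restrict F.size F.size_pos H) ∂μ =
        ∫ H, tInj c F (LInfty.restrict F.size F.size_pos H) ∂ν) : μ = ν := by
  have := hμ.1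
  have := hν.1
  refine ext_of_integral_monomial fun k hk a => ?_
  have h1 := h (Quotient.mk _ ⟨k, hk, a⟩)
  exact (integral_tInj hμ c ⟨k, hk, a⟩).symm.trans (h1.trans (integral_tInj hν c ⟨k, hk, a⟩))

variable [Nonempty K] (h_countable : 𝓕.Countable)
  (h_gen : Dense (Submodule.span ℝ 𝓕 : Set C(K, ℝ)))

include h_countable in
theorem integral_tLim_eq_integral_tInj (P : Measure (LimitSpace r c 𝓕)) [IsProbabilityMeasure P]
    (F : Unlabeled r C(K, ℝ)) :
    ∫ Γ, tLim F Γ ∂P =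
      ∫ H, tInj c F (LInfty.restrict F.size F.size_pos H) ∂(mixture h_gen P) := by
  rw [integral_tInj_restrict (mixture_mem h_countable h_gen P) c F,
    integral_mixture_monomial h_countable h_gen]
  exact congrArg (fun F : Unlabeled r C(K, ℝ) => ∫ Γ : LimitSpace r c 𝓕, tLim F Γ ∂P)
    F.out_eq.symm

theorem tLim_eq_integral_tInj (Γ : LimitSpace r c 𝓕) (F : Unlabeled r C(K, ℝ)) :
    tLim F Γ = ∫ H, tInj c F (LInfty.restrict F.size F.size_pos H)
      ∂(limitLaw h_gen Γ : Measure (LInfty r K)) := by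
  rw [integral_tInj_restrict (limitLaw_mem h_gen Γ) c F, tLim_eq_integral h_gen]

include h_countable in
theorem mem_extremePoints_exchangeableLaws {ν : Measure (LInfty r K)} :
    ν ∈ (exchangeableLaws r K).extremePoints ℝ≥0 ↔
      ∃ Γ : LimitSpace r c 𝓕, (limitLaw h_gen Γ : Measure (LInfty r K)) = ν := by
  have := borelSpace_limitSpace (r := r) (c := c) h_countable
  have := polishSpace_limitSpace (r := r) (c := c) h_countable
  exact mem_extremePoints_iff_of_bind (measurable_limitLaw (c := c) h_countable h_gen)
    (fun P _ => mixture_mem h_countable h_gen P)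
    (fun P Q _ _ h => mixture_injective h_countable h_gen h)
    (fun ν hν => mixture_surjective h_countable h_gen hν)

include h_countable in
theorem mixture_dirac (Γ : LimitSpace r c 𝓕) :
    mixture h_gen (Measure.dirac Γ) = (limitLaw h_gen Γ : Measure (LInfty r K)) :=
  Measure.dirac_bind (measurable_limitLaw h_countable h_gen) Γ

/-- The correspondence between laws of random limit points and exchangeable laws. -/
def lawEquiv : ProbabilityMeasure (LimitSpace r c 𝓕) ≃ exchangeableLaws r K :=
  Equiv.ofBijective (fun P => ⟨mixture h_gen (P : Measure (LimitSpace r c 𝓕)),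
      mixture_mem h_countable h_gen _⟩)
    ⟨fun _ _ h => ProbabilityMeasure.toMeasure_injective
        (mixture_injective h_countable h_gen (congrArg Subtype.val h)),
      fun ν => by
        obtain ⟨P, hP, h⟩ := mixture_surjective (c := c) h_countable h_gen ν.2
        exact ⟨⟨P, hP⟩, Subtype.ext h⟩⟩

/-- The correspondence between limit points and extreme exchangeable laws. -/
def extremeLawEquiv : LimitSpace r c 𝓕 ≃ Set.extremePoints ℝ≥0 (exchangeableLaws r K) :=
  Equiv.ofBijective (fun Γ => ⟨(limitLaw h_gen Γ : Measure (LInfty r K)),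
      (mem_extremePoints_exchangeableLaws h_countable h_gen).2 ⟨Γ, rfl⟩⟩)
    ⟨fun Γ Γ' h => by
        have := borelSpace_limitSpace (r := r) (c := c) h_countable
        have h' : (limitLaw h_gen Γ : Measure (LInfty r K)) = limitLaw h_gen Γ' :=
          congrArg (fun ν : Set.extremePoints ℝ≥0 (exchangeableLaws r K) =>
            (ν : Measure (LInfty r K))) h
        refine Subtype.ext (Prod.ext (funext fun F => ?_)
          ((limitSpace_snd Γ).trans (limitSpace_snd Γ').symm))
        rw [← tLim_map_val h_gen, ← tLim_map_val h_gen, tLim_eq_integral h_gen,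
          tLim_eq_integral h_gen, h'],
      fun ν => by
        obtain ⟨Γ, h⟩ := (mem_extremePoints_exchangeableLaws h_countable h_gen (c := c)).1 ν.2
        exact ⟨Γ, Subtype.ext h⟩⟩

theorem lawEquiv_eq_iff (P : ProbabilityMeasure (LimitSpace r c 𝓕)) (ν : exchangeableLaws r K) :
    lawEquiv h_countable h_gen P = ν ↔ ∀ F : Unlabeled r C(K, ℝ),
      ∫ Γ, tLim F Γ ∂(P : Measure (LimitSpace r c 𝓕)) =
        ∫ H, tInj c F (LInfty.restrict F.size F.size_pos H) ∂(ν : Measure (LInfty r K)) := by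
  constructor
  · rintro rfl F
    exact integral_tLim_eq_integral_tInj h_countable h_gen (P : Measure (LimitSpace r c 𝓕)) F
  · refine fun h => Subtype.ext (ext_of_integral_tInj (mixture_mem h_countable h_gen
      (P : Measure (LimitSpace r c 𝓕))) ν.2 c fun F => ?_)
    exact (integral_tLim_eq_integral_tInj h_countable h_gen
      (P : Measure (LimitSpace r c 𝓕)) F).symm.trans (h F)

theorem extremeLawEquiv_eq_iff (Γ : LimitSpace r c 𝓕)
    (ν : Set.extremePoints ℝ≥0 (exchangeableLaws r K)) :
    extremeLawEquiv h_countable h_gen Γ = ν ↔ ∀ F : Unlabeled r C(K, ℝ),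
      tLim F Γ =
        ∫ H, tInj c F (LInfty.restrict F.size F.size_pos H) ∂(ν : Measure (LInfty r K)) := by
  constructor
  · rintro rfl F
    exact tLim_eq_integral_tInj h_gen Γ F
  · refine fun h => Subtype.ext (ext_of_integral_tInj (limitLaw_mem h_gen Γ)
      (extremePoints_subset ν.2) c fun F => ?_)
    exact (tLim_eq_integral_tInj h_gen Γ F).symm.trans (h F)

end Characterization

/-! ### The case of an empty decoration space -/

section Empty

variable {K : Type*} [TopologicalSpace K] [CompactSpace K] [IsEmpty K] {r : ℕ}
  {c : C(K, ℝ) → ℝ} {𝓕 : Set C(K, ℝ)}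

/-- Near a limit point there are hypergraphs with at least r vertices, and such a hypergraph carries
a decoration in K. -/
theorem isEmpty_limitSpace : IsEmpty (LimitSpace r c 𝓕) := by
  refine ⟨fun Γ => ?_⟩
  have := neBot_nhdsTrace Γ
  obtain ⟨G, hG⟩ := ((tendsto_size_nhdsTrace Γ).eventually_ge_atTop r).exists
  rw [Unlabeled.size_eq_out] at hG
  exact isEmptyElim (G.out.arr (Fin.castLEEmb hG))

omit [TopologicalSpace K] [CompactSpace K] in
theorem isEmpty_exchangeableLaws [MeasurableSpace K] : IsEmpty (exchangeableLaws r K) := by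
  refine ⟨fun ν => ?_⟩
  have := ν.2.1
  obtain ⟨H⟩ := nonempty_of_isProbabilityMeasure (ν : Measure (LInfty r K))
  exact isEmptyElim (H Fin.valEmbedding)

end Empty

end DecoratedHypergraph

end

theorem theorem2p5 {K : Type*} [TopologicalSpace K] [PolishSpace K] [CompactSpace K]
    [MeasurableSpace K] [BorelSpace K] {r : ℕ} (hr : 1 ≤ r)
    -- the values `f(ι)` of the functionals at the special element of the diagonal
    (c : C(K, ℝ) → ℝ)
    (𝓕 : Set C(K, ℝ)) (h_countable : 𝓕.Countable) (h_norm : ∀ f ∈ 𝓕, ‖f‖ ≤ 1)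
    (h_gen : Dense (Submodule.span ℝ 𝓕 : Set C(K, ℝ))) :
    -- `t(F, ·)` extends continuously to the limit points, with the expected values on `Π(𝓕)`
    (∀ F : Unlabeled r C(K, ℝ),
      (∀ Γ : LimitSpace r c 𝓕, (nhdsTrace Γ).NeBot ∧
        Tendsto (t c F) (nhdsTrace Γ) (𝓝 (tLim F Γ))) ∧
      Continuous (fun Γ : LimitSpace r c 𝓕 => tLim F Γ) ∧
      ∀ P : ProbabilityMeasure (LimitSpace r c 𝓕),
        Integrable (fun Γ : LimitSpace r c 𝓕 => tLim F Γ) (P : Measure (LimitSpace r c 𝓕))) ∧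
    (∀ (F : Unlabeled r 𝓕) (Γ : LimitSpace r c 𝓕), tLim (F.map Subtype.val) Γ = Γ.1.1 F) ∧
    -- the two one-to-one correspondences
    ∃ (Φ : ProbabilityMeasure (LimitSpace r c 𝓕) ≃ exchangeableLaws r K)
      (Ψ : LimitSpace r c 𝓕 ≃ Set.extremePoints ℝ≥0 (exchangeableLaws r K)),
      (∀ P ν, Φ P = ν ↔ ∀ F : Unlabeled r C(K, ℝ),
        ∫ Γ, tLim F Γ ∂(P : Measure (LimitSpace r c 𝓕)) =
          ∫ H, tInj c F (LInfty.restrict F.size F.size_pos H) ∂(ν : Measure (LInfty r K))) ∧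
      (∀ Γ ν, Ψ Γ = ν ↔ ∀ F : Unlabeled r C(K, ℝ),
        tLim F Γ =
          ∫ H, tInj c F (LInfty.restrict F.size F.size_pos H) ∂(ν : Measure (LInfty r K))) ∧
      ∀ Γ, (Ψ Γ : Measure (LInfty r K)) = Φ ⟨Measure.dirac Γ, inferInstance⟩ := by
  -- Filling the diagonal needs a point of K. If K is empty, X and the set of exchangeable laws are
  -- empty, and every claim is vacuous.
  rcases isEmpty_or_nonempty K with hK | hK
  · have h1 : IsEmpty (LimitSpace r c 𝓕) := isEmpty_limitSpace
    have h2 : IsEmpty (exchangeableLaws r K) := isEmpty_exchangeableLaws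
    have h3 : IsEmpty (ProbabilityMeasure (LimitSpace r c 𝓕)) :=
      ⟨fun P => isEmptyElim P.nonempty.some⟩
    have h4 : IsEmpty (Set.extremePoints ℝ≥0 (exchangeableLaws r K)) :=
      ⟨fun ν => isEmptyElim (⟨ν, extremePoints_subset ν.2⟩ : exchangeableLaws r K)⟩
    exact ⟨fun F => ⟨isEmptyElim, continuous_of_const isEmptyElim, isEmptyElim⟩,
      fun F => isEmptyElim, Equiv.equivOfIsEmpty _ _, Equiv.equivOfIsEmpty _ _,
      isEmptyElim, isEmptyElim, isEmptyElim⟩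
  · have := borelSpace_limitSpace (r := r) (c := c) h_countable
    exact ⟨fun F => ⟨fun Γ => ⟨neBot_nhdsTrace Γ, tendsto_tLim h_gen F Γ⟩,
      continuous_tLim h_gen F, fun P => integrable_of_continuousMap ⟨_, continuous_tLim h_gen F⟩ _⟩,
      tLim_map_val h_gen, lawEquiv h_countable h_gen, extremeLawEquiv h_countable h_gen,
      lawEquiv_eq_iff h_countable h_gen, extremeLawEquiv_eq_iff h_countable h_gen,
      fun Γ => (mixture_dirac h_countable h_gen Γ).symm⟩
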